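/- Run randomized Quicksort on the keys $X_1,\dots,X_N$, where $N$ is Poisson with mean $\lambda>0$ and $X_1,X_2,\dots$ are independent, uniformly distributed on $(0,1)$ and independent of $N$. (An array of at most one key needs no work; otherwise a pivot is chosen uniformly at random from the array, all other keys are compared with it, and the algorithm is applied recursively and independently to the keys smaller than the pivot and to those larger than it.) A comparison of two distinct keys $x,y$ costs $b(x,y)$ bit comparisons, where $b(x,y)\in\{1,2,\dots\}$ is the index of the first bit at which the binary expansions of $x$ and $y$ differ (the terminating expansion is used for dyadic rationals). Let $K(\lambda)$ be the total number of key comparisons and $B(\lambda)$ the total number of bit comparisons. Then: 1. There is a constant $c$ such that, for all $0<\lambda<\infty$, $B(\lambda)$ is square integrable and $$\operatorname{Var} B(\lambda)\le c^2\lambda^2 .$$ 2. About $\frac12\lg\lambda$ bits are compared per key comparison, where $\lg=\log_2$, in the sense that $$\frac{2}{\lg\lambda}\cdot\frac{B(\lambda)}{K(\lambda)}\longrightarrow 1\quad\text{in probability as }\lambda\to\infty .$$ (The quotient $B(\lambda)/K(\lambda)$ is read as $0$ when $K(\lambda)=0$, an event whose probability tends to $0$.) -/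

import Mathlib

open MeasureTheory ProbabilityTheory Filter Topology
open scoped NNReal ENNReal

namespace BitQuicksort

/-- The index (counted from `1`) of the first bit at which the binary expansions of `x` and `y`
differ, for distinct `x, y ∈ [0, 1)`; dyadic rationals have the terminating expansion.
This is the number of bits that are compared when the keys `x` and `y` are compared bit by bit. -/
noncomputable def bitCost (x y : ℝ) : ℕ :=
  sInf {i : ℕ | Real.digits x 2 i ≠ Real.digits y 2 i} + 1

/-- Randomized Quicksort. The keys to be sorted are `key i` for the labels `i ∈ S`, and
comparing the keys `x` and `y` costs `cost x y`. The value is the distribution, over the random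
choices of the pivots, of the total cost of all key comparisons.

If there are no keys, nothing is done. Otherwise a pivot `p` is chosen uniformly at random from
the keys, all other keys are compared with it (no comparison for a single key), and the keys
that are smaller than the pivot and those that are not are sorted recursively, with independent
randomness. -/
noncomputable def quicksortCost {ι M : Type*} [DecidableEq ι] [AddCommMonoid M]
    (key : ι → ℝ) (cost : ℝ → ℝ → M) (S : Finset ι) : PMF M :=
  if h : S.Nonempty then
    haveI : Nonempty S := h.to_subtype
    (PMF.uniformOfFintype S).bind fun p =>
      (quicksortCost key cost ((S.erase p).filter fun j => key j < key p)).bind fun a =>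
        (quicksortCost key cost ((S.erase p).filter fun j => key p ≤ key j)).bind fun b =>
          PMF.pure ((∑ j ∈ S.erase p, cost (key p) (key j)) + a + b)
  else PMF.pure 0
termination_by S.card
decreasing_by
  all_goals
    exact lt_of_le_of_lt (Finset.card_filter_le _ _) (Finset.card_erase_lt_of_mem p.2)

/-- The uniform distribution on `(0, 1)`. -/
noncomputable def unif : Measure ℝ := volume.restrict (Set.Ioo 0 1)

instance : IsProbabilityMeasure unif := ⟨by simp [unif]⟩

/-- The joint distribution of (number of key comparisons, number of bit comparisons) when
Quicksort is run on the given keys `x 0, …, x (n - 1)`. -/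
noncomputable def costLaw (n : ℕ) (x : Fin n → ℝ) : Measure (ℕ × ℕ) :=
  (quicksortCost x (fun s t => ((1 : ℕ), bitCost s t)) Finset.univ).toMeasure

/-- The joint distribution of `(K(lam), B(lam))`, the numbers of key comparisons and of bit
comparisons, in the Poissonized uniform model: the number `n` of keys is Poisson with mean `lam`,
and given `n` the keys are independent and uniform on `(0, 1)`. -/
noncomputable def poissonLaw (lam : ℝ≥0) : Measure (ℕ × ℕ) :=
  (poissonMeasure lam).bind fun n => (Measure.pi fun _ : Fin n => unif).bind (costLaw n)

/-- The number `K` of key comparisons, as a real random variable on the space of outcomes. -/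
def keyComparisons (z : ℕ × ℕ) : ℝ := z.1

/-- The number `B` of bit comparisons, as a real random variable on the space of outcomes. -/
def bitComparisons (z : ℕ × ℕ) : ℝ := z.2

theorem measurable_bitCost : Measurable fun z : ℝ × ℝ => bitCost z.1 z.2 := by
  have hd : ∀ i : ℕ, Measurable fun x : ℝ => Real.digits x 2 i := by
    intro i
    unfold Real.digits
    exact (measurable_of_countable (Fin.ofNat 2)).comp
      (Nat.measurable_floor.comp (measurable_id.mul_const _))
  have hset : ∀ i : ℕ,
      MeasurableSet {z : ℝ × ℝ | Real.digits z.1 2 i ≠ Real.digits z.2 2 i} := fun i =>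
    (measurableSet_eq_fun ((hd i).comp measurable_fst) ((hd i).comp measurable_snd)).compl
  have hinf : Measurable fun z : ℝ × ℝ =>
      sInf {i : ℕ | Real.digits z.1 2 i ≠ Real.digits z.2 2 i} := by
    refine measurable_of_Iio fun n => ?_
    have : (fun z : ℝ × ℝ => sInf {i : ℕ | Real.digits z.1 2 i ≠ Real.digits z.2 2 i}) ⁻¹'
        Set.Iio n = (if 0 < n then (⋂ i : ℕ,
          {z : ℝ × ℝ | Real.digits z.1 2 i ≠ Real.digits z.2 2 i}ᶜ) else ∅) ∪
          ⋃ i ∈ Finset.range n, {z : ℝ × ℝ | Real.digits z.1 2 i ≠ Real.digits z.2 2 i} := by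
      ext z
      set T : Set ℕ := {i : ℕ | Real.digits z.1 2 i ≠ Real.digits z.2 2 i} with hT
      have e1 : (z ∈ ⋃ i ∈ Finset.range n,
          {z : ℝ × ℝ | Real.digits z.1 2 i ≠ Real.digits z.2 2 i}) ↔ ∃ i < n, i ∈ T := by
        simp [hT]
      have e2 : (z ∈ (if 0 < n then (⋂ i : ℕ,
          {z : ℝ × ℝ | Real.digits z.1 2 i ≠ Real.digits z.2 2 i}ᶜ) else ∅)) ↔
            0 < n ∧ T = ∅ := by
        split_ifs with h
        · simp [hT, h, Set.eq_empty_iff_forall_notMem]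
        · simp [h]
      rw [Set.mem_union, e1, e2, Set.mem_preimage, Set.mem_Iio]
      rcases T.eq_empty_or_nonempty with h | h
      · have h0 : sInf {i : ℕ | Real.digits z.1 2 i ≠ Real.digits z.2 2 i} = 0 := by
          rw [← hT, h, Nat.sInf_empty]
        rw [h0]
        simp [h]
      · constructor
        · exact fun hlt => Or.inr ⟨_, hlt, Nat.sInf_mem h⟩
        · rintro (⟨-, h0⟩ | ⟨i, hi, hiT⟩)
          · exact absurd h0 h.ne_empty
          · exact (Nat.sInf_le hiT).trans_lt hi
    rw [this]
    refine MeasurableSet.union ?_ (Finset.measurableSet_biUnion _ fun i _ => hset i)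
    split_ifs
    · exact MeasurableSet.iInter fun i => (hset i).compl
    · exact MeasurableSet.empty
  exact hinf.add_const 1

theorem measurable_quicksortCost {ι M : Type*} [DecidableEq ι] [Finite ι] [AddCommMonoid M]
    [Countable M] [MeasurableSpace M] [DiscreteMeasurableSpace M]
    {cost : ℝ → ℝ → M} (hc : Measurable fun z : ℝ × ℝ => cost z.1 z.2) (S : Finset ι) (m : M) :
    Measurable fun x : ι → ℝ => quicksortCost x cost S m := by
  classical
  induction hn : S.card using Nat.strong_induction_on generalizing S m with
  | _ n ih =>
    subst hn
    by_cases h : S.Nonempty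
    · have : Nonempty S := h.to_subtype
      have key : ∀ (p : S) (F : (ι → ℝ) → ι → Prop)
          (_ : ∀ j, MeasurableSet {x : ι → ℝ | F x j}) (a : M),
          Measurable fun x : ι → ℝ =>
            quicksortCost x cost ((S.erase p).filter fun j => F x j) a := by
        intro p F hF a
        have : (fun x : ι → ℝ => quicksortCost x cost ((S.erase p).filter fun j => F x j) a) =
            fun x => ∑ T ∈ (S.erase p).powerset,
              Set.indicator {x | ((S.erase p).filter fun j => F x j) = T}
                (fun x => quicksortCost x cost T a) x := by
          funext x
          rw [Finset.sum_eq_single ((S.erase p).filter fun j => F x j)]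
          · simp
          · intro T _ hT
            exact Set.indicator_of_notMem (fun hx => hT hx.symm) _
          · intro hx
            exact absurd (Finset.mem_powerset.2 (Finset.filter_subset _ _)) hx
        rw [this]
        refine Finset.measurable_sum _ fun T hT => Measurable.indicator ?_ ?_
        · refine ih T.card ?_ T a rfl
          exact lt_of_le_of_lt (Finset.card_le_card (Finset.mem_powerset.1 hT))
            (Finset.card_erase_lt_of_mem p.2)
        · have e : {x : ι → ℝ | ((S.erase p).filter fun j => F x j) = T} =
              ⋂ j : ι, {x | (j ∈ S.erase (p : ι) ∧ F x j) ↔ j ∈ T} := by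
            ext x
            simp only [Set.mem_ofPred_eq, Set.mem_iInter, Finset.ext_iff, Finset.mem_filter]
          rw [e]
          refine MeasurableSet.iInter fun j => ?_
          have h1 : MeasurableSet {x : ι → ℝ | j ∈ S.erase (p : ι) ∧ F x j} :=
            (MeasurableSet.const _).inter (hF j)
          by_cases hj : j ∈ T
          · simpa [hj] using h1
          · simp only [hj, iff_false]
            exact h1.compl
      have e : (fun x : ι → ℝ => quicksortCost x cost S m) = fun x =>
          ∑' p : S, (PMF.uniformOfFintype S p) *
            ∑' a : M, quicksortCost x cost ((S.erase (p : ι)).filter fun j : ι => x j < x (p : ι)) a *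
              ∑' b : M, quicksortCost x cost ((S.erase (p : ι)).filter fun j : ι => x (p : ι) ≤ x j) b *
                PMF.pure ((∑ j ∈ S.erase (p : ι), cost (x (p : ι)) (x j)) + a + b) m := by
        funext x
        rw [quicksortCost, dif_pos h]
        simp only [PMF.bind_apply]
      rw [e]
      refine Measurable.tsum fun p => Measurable.const_mul ?_ _
      have hlt := key p (fun x (j : ι) => x j < x (p : ι)) fun j =>
        measurableSet_lt (measurable_pi_apply _) (measurable_pi_apply _)
      have hge := key p (fun x (j : ι) => x (p : ι) ≤ x j) fun j =>
        measurableSet_le (measurable_pi_apply _) (measurable_pi_apply _)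
      refine Measurable.tsum fun a => (hlt a).mul ?_
      refine Measurable.tsum fun b => (hge b).mul ?_
      have hcost : Measurable fun x : ι → ℝ => fun j : ι => cost (x (p : ι)) (x j) :=
        measurable_pi_lambda _ fun j => by
          have h2 : Measurable fun x : ι → ℝ => (x (p : ι), x j) :=
            (measurable_pi_apply _).prodMk (measurable_pi_apply _)
          exact hc.comp h2
      exact (measurable_of_countable
        (fun v : ι → M => PMF.pure ((∑ j ∈ S.erase (p : ι), v j) + a + b) m)).comp hcost
    · have : (fun x : ι → ℝ => quicksortCost x cost S m) = fun _ => PMF.pure 0 m := by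
        funext x
        rw [quicksortCost, dif_neg h]
      rw [this]
      exact measurable_const

/-- `costLaw n` depends measurably on the keys, so that `poissonLaw` is a genuine mixture. -/
theorem measurable_costLaw (n : ℕ) : Measurable (costLaw n) := by
  refine Measure.measurable_of_measurable_coe _ fun s hs => ?_
  have hc : Measurable fun z : ℝ × ℝ => ((1 : ℕ), bitCost z.1 z.2) :=
    measurable_const.prodMk measurable_bitCost
  simp only [costLaw, PMF.toMeasure_apply_eq_tsum]
  refine Measurable.tsum fun z => ?_
  by_cases hz : z ∈ s
  · simpa [hz] using measurable_quicksortCost hc Finset.univ z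
  · simp [hz]

instance (lam : ℝ≥0) : IsProbabilityMeasure (poissonLaw lam) := by
  have h : ∀ n : ℕ, IsProbabilityMeasure
      ((Measure.pi fun _ : Fin n => unif).bind (costLaw n)) := fun n =>
    isProbabilityMeasure_bind (measurable_costLaw n).aemeasurable
      (Eventually.of_forall fun x => by unfold costLaw; infer_instance)
  exact isProbabilityMeasure_bind (measurable_of_countable _).aemeasurable
    (Eventually.of_forall h)

end BitQuicksort

/-! Two keys whose first differing bit has index b share a dyadic interval of length 2^(-k) exactly
for k = 0, …, b - 1. Hence B is the sum over levels k ≥ 0 of the number of comparisons made between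
keys in a common interval of level k, and level 0 alone gives K. A pivot splits only its own
interval at each level, and its rank among the keys there is uniform, so each interval behaves like
a Quicksort on its own keys. With C(n) = `meanKey n`, the centre for fixed keys is the sum of C over
the occupancies of all intervals.

The randomness of the pivots and that of the keys are then bounded separately. For fixed keys, the
pivot contributes a centred increment to the cost, of size at most 5(n - 1) at a level where its
interval holds n keys. The increments at different levels are dependent and are combined by
Cauchy–Schwarz with weights (3/2)^k. The weighted number of ordered pairs in common intervals serves
as a potential: its mean decrease under a split pays for the squared increment
(`tsum_quicksortCost_sq_le`).

For Poisson N, the occupancies at level k are independent Poisson variables of mean λ/2^k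
(`lintegral_classCount`). A Poisson variable of mean μ has E[N(N-1)] = μ² and Var C(N) ≤ 40μ², for
small μ as well. The 2^k intervals therefore contribute O(λ²/2^k), which is summable against
(3/2)^k. This gives a second moment O(λ²) about an explicit centre (`lintegral_bit_le`), hence the
variance bound.

For the ratio, E C(N) = 2μ log μ + O(μ) when μ ≥ 1, and E C(N) ≤ μ² always. Summing over levels puts
the centre of B at log 2 · λ lg²λ + O(λ lg λ), while that of K is 2λ log λ + O(λ). Fluctuations are
O(λ), so Chebyshev's inequality concludes. -/

namespace BitQuicksort

/-! ### Harmonic numbers and the Quicksort recurrence -/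

/-- The mean number of key comparisons used by Quicksort on `n` distinct keys. -/
noncomputable def meanKey (n : ℕ) : ℝ := 2 * (n + 1) * (harmonic n : ℝ) - 4 * n

theorem cast_harmonic_succ (n : ℕ) :
    (harmonic (n + 1) : ℝ) = (harmonic n : ℝ) + ((n : ℝ) + 1)⁻¹ := by
  rw [harmonic_succ]; push_cast; ring

@[simp] theorem meanKey_zero : meanKey 0 = 0 := by simp [meanKey]

@[simp] theorem meanKey_one : meanKey 1 = 0 := by
  have := cast_harmonic_succ 0
  simp only [zero_add] at this
  rw [meanKey, this]; simp; norm_num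

theorem meanKey_succ (n : ℕ) :
    meanKey (n + 1) = meanKey n + 2 * ((harmonic (n + 1) : ℝ) - 1) := by
  have h : ((n : ℝ) + 1) ≠ 0 := by positivity
  rw [meanKey, meanKey, cast_harmonic_succ]
  push_cast
  field_simp
  ring

/-- This is the Quicksort recurrence n C(n) = n(n - 1) + 2 ∑ C(r), which justifies the closed form
chosen for `meanKey`. -/
theorem two_mul_sum_meanKey (n : ℕ) :
    2 * ∑ r ∈ Finset.range n, meanKey r = n * meanKey n - n * (n - 1) := by
  induction n with
  | zero => simp
  | succ n ih =>
    have h : ((n : ℝ) + 1) ≠ 0 := by positivity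
    rw [Finset.sum_range_succ, mul_add, ih, meanKey_succ, cast_harmonic_succ, meanKey]
    push_cast
    field_simp
    ring

/-- The increment of `f` when a set of size `n` is split by its element of rank `r`. -/
noncomputable def splitDefect (f : ℕ → ℝ) (n r : ℕ) : ℝ := f r + f (n - 1 - r) - f n

theorem sum_splitDefect (f : ℕ → ℝ) (n : ℕ) :
    ∑ r ∈ Finset.range n, splitDefect f n r = 2 * ∑ r ∈ Finset.range n, f r - n * f n := by
  simp only [splitDefect, Finset.sum_sub_distrib, Finset.sum_add_distrib, Finset.sum_range_reflect]
  simp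
  ring

theorem sum_splitDefect_meanKey (n : ℕ) :
    ∑ r ∈ Finset.range n, (((n : ℝ) - 1) + splitDefect meanKey n r) = 0 := by
  rw [Finset.sum_add_distrib, sum_splitDefect, two_mul_sum_meanKey]
  simp
  ring

/-- A split at a uniform rank leaves fewer than 2/3 of the ordered pairs on average; this loss is
what makes the pair count usable as a potential. -/
theorem two_mul_sum_pairs (n : ℕ) :
    2 * ∑ r ∈ Finset.range n, ((r : ℝ) * (r - 1)) = 2 / 3 * (n * (n - 1) * (n - 2)) := by
  induction n with
  | zero => simp
  | succ n ih => rw [Finset.sum_range_succ, mul_add, ih]; push_cast; ring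

theorem harmonic_sub_nonneg_le {m n : ℕ} (h : m ≤ n) :
    0 ≤ (harmonic n : ℝ) - harmonic m ∧
      ((m : ℝ) + 1) * ((harmonic n : ℝ) - harmonic m) ≤ n - m := by
  induction n, h using Nat.le_induction with
  | base => simp
  | succ n hmn ih =>
    have hn : (0 : ℝ) < n + 1 := by positivity
    have hm : (m : ℝ) ≤ n := by exact_mod_cast hmn
    have h1 : ((m : ℝ) + 1) * ((n : ℝ) + 1)⁻¹ ≤ 1 := by
      rw [← div_eq_mul_inv, div_le_one hn]; linarith
    rw [cast_harmonic_succ]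
    refine ⟨?_, ?_⟩
    · have : 0 ≤ ((n : ℝ) + 1)⁻¹ := by positivity
      linarith [ih.1]
    · push_cast
      nlinarith [ih.2]

/-- With n = r + s + 1 the quantity equals n + 3 - 2(r + 1)(H_n - H_r) - 2(s + 1)(H_n - H_s). The
two products lie in [0, s + 1] and [0, r + 1], so it lies between -(n - 1) and n + 3, and n + 3 ≤
5(n - 1) once n ≥ 2. For n = 1 it vanishes. -/
theorem abs_toll_add_splitDefect_le {n r : ℕ} (h : r < n) :
    |((n : ℝ) - 1) + splitDefect meanKey n r| ≤ 5 * (n - 1) := by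
  obtain ⟨s, rfl⟩ : ∃ s, n = r + s + 1 := ⟨n - 1 - r, by omega⟩
  have e : r + s + 1 - 1 - r = s := by omega
  obtain ⟨a0, a1⟩ := harmonic_sub_nonneg_le (show r ≤ r + s + 1 by omega)
  obtain ⟨b0, b1⟩ := harmonic_sub_nonneg_le (show s ≤ r + s + 1 by omega)
  rcases Nat.eq_zero_or_pos (r + s) with h0 | h0
  · obtain ⟨rfl, rfl⟩ : r = 0 ∧ s = 0 := by omega
    simp [splitDefect]
  have h1 : (1 : ℝ) ≤ r + s := by exact_mod_cast h0
  have hr : (0 : ℝ) ≤ r := by positivity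
  have hs : (0 : ℝ) ≤ s := by positivity
  have a2 := mul_nonneg (show (0 : ℝ) ≤ r + 1 by positivity) a0
  have b2 := mul_nonneg (show (0 : ℝ) ≤ s + 1 by positivity) b0
  rw [splitDefect, e, meanKey, meanKey, meanKey]
  push_cast at *
  rw [abs_le]
  constructor <;> nlinarith

/-! ### Cells of keys under a pivot split -/

section Cells

variable {ι : Type*}

/-- The number of labels in `S` whose key lies in the cell `c`. -/
def cellCount (q : ℝ → ℕ) (x : ι → ℝ) (S : Finset ι) (c : ℕ) : ℕ :=
  (S.filter fun j => q (x j) = c).card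

/-- The rank of the key of `p` among the keys of `S` in the same cell. -/
noncomputable def cellRank (q : ℝ → ℕ) (x : ι → ℝ) (S : Finset ι) (p : ι) : ℕ :=
  ((S.filter fun j => q (x j) = q (x p)).filter fun j => x j < x p).card

theorem cellRank_lt {q : ℝ → ℕ} {x : ι → ℝ} {S : Finset ι} {p : ι} (hp : p ∈ S) :
    cellRank q x S p < cellCount q x S (q (x p)) := by
  refine Finset.card_lt_card ?_
  rw [Finset.ssubset_iff_of_subset (Finset.filter_subset _ _)]
  exact ⟨p, by simp [hp], by simp⟩

/-- Distinct keys have ranks 0, …, |C| - 1, each once; the induction inserts the largest key last,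
which leaves the other ranks unchanged. -/
theorem sum_rank {x : ι → ℝ} {C : Finset ι} (hx : Set.InjOn x C) (g : ℕ → ℝ) :
    ∑ p ∈ C, g (C.filter fun j => x j < x p).card = ∑ r ∈ Finset.range C.card, g r := by
  classical
  induction C using Finset.induction_on_max_value x with
  | empty => simp
  | insert a s ha hmax ih =>
    have hx' : Set.InjOn x s := hx.mono (by simp)
    have hlt : ∀ j ∈ s, x j < x a := fun j hj => lt_of_le_of_ne (hmax j hj) fun he =>
      ha (hx (by simp [hj]) (by simp) he ▸ hj)
    rw [Finset.sum_insert ha, Finset.card_insert_of_notMem ha, Finset.sum_range_succ, ← ih hx',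
      add_comm]
    congr 1
    · refine Finset.sum_congr rfl fun p hp => ?_
      rw [Finset.filter_insert, if_neg (hlt p hp).not_gt]
    · rw [Finset.filter_insert, if_neg (lt_irrefl _), Finset.filter_true_of_mem hlt]

/-- A uniform pivot has, given its cell, a uniform rank in that cell. Averages over pivots thus
reduce to the one-cell identities above. -/
theorem sum_cellRank {q : ℝ → ℕ} {x : ι → ℝ} {S : Finset ι} (hx : Set.InjOn x S)
    {R : Finset ℕ} (hR : ∀ i ∈ S, q (x i) ∈ R) (g : ℕ → ℕ → ℝ) :
    ∑ p ∈ S, g (cellCount q x S (q (x p))) (cellRank q x S p) =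
      ∑ c ∈ R, ∑ r ∈ Finset.range (cellCount q x S c), g (cellCount q x S c) r := by
  rw [← Finset.sum_fiberwise_of_maps_to hR]
  refine Finset.sum_congr rfl fun c _ => ?_
  rw [cellCount, ← sum_rank (hx.mono (Finset.coe_subset.2 (Finset.filter_subset _ _)))]
  refine Finset.sum_congr rfl fun p hp => ?_
  obtain ⟨-, rfl⟩ := Finset.mem_filter.1 hp
  rfl

/-- Since `q` is monotone, cells are consecutive in the order of the keys: every cell other than the
pivot's stays whole on one side and is empty on the other, where `f0` removes it. -/
theorem sum_cellCount_split [DecidableEq ι] {q : ℝ → ℕ} (hq : Monotone q) {x : ι → ℝ} {S : Finset ι}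
    (f : ℕ → ℝ) (f0 : f 0 = 0) {R : Finset ℕ} {p : ι} (hp : p ∈ S) (hR : q (x p) ∈ R) :
    ∑ c ∈ R, f (cellCount q x ((S.erase p).filter fun j => x j < x p) c) +
      ∑ c ∈ R, f (cellCount q x ((S.erase p).filter fun j => x p ≤ x j) c) =
    ∑ c ∈ R, f (cellCount q x S c) +
      splitDefect f (cellCount q x S (q (x p))) (cellRank q x S p) := by
  have hother : ∀ c ∈ R.erase (q (x p)),
      f (cellCount q x ((S.erase p).filter fun j => x j < x p) c) +
      f (cellCount q x ((S.erase p).filter fun j => x p ≤ x j) c) = f (cellCount q x S c) := by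
    intro c hc
    have hc' : c ≠ q (x p) := (Finset.mem_erase.1 hc).1
    rcases lt_or_gt_of_ne hc' with h | h
    · have e1 : cellCount q x ((S.erase p).filter fun j => x p ≤ x j) c = 0 := by
        rw [cellCount, Finset.card_eq_zero, Finset.filter_eq_empty_iff]
        intro j hj he
        have := hq (Finset.mem_filter.1 hj).2
        omega
      have e2 : cellCount q x ((S.erase p).filter fun j => x j < x p) c = cellCount q x S c := by
        unfold cellCount
        congr 1
        ext j
        simp only [Finset.mem_filter, Finset.mem_erase]
        constructor
        · tauto
        · rintro ⟨h1, h2⟩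
          refine ⟨⟨⟨?_, h1⟩, ?_⟩, h2⟩
          · rintro rfl; exact hc' h2.symm
          · by_contra hcon
            have := hq (not_lt.1 hcon)
            omega
      rw [e1, e2, f0, add_zero]
    · have e1 : cellCount q x ((S.erase p).filter fun j => x j < x p) c = 0 := by
        rw [cellCount, Finset.card_eq_zero, Finset.filter_eq_empty_iff]
        intro j hj he
        have := hq (Finset.mem_filter.1 hj).2.le
        omega
      have e2 : cellCount q x ((S.erase p).filter fun j => x p ≤ x j) c = cellCount q x S c := by
        unfold cellCount
        congr 1
        ext j
        simp only [Finset.mem_filter, Finset.mem_erase]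
        constructor
        · tauto
        · rintro ⟨h1, h2⟩
          refine ⟨⟨⟨?_, h1⟩, ?_⟩, h2⟩
          · rintro rfl; exact hc' h2.symm
          · by_contra hcon
            have := hq (not_le.1 hcon).le
            omega
      rw [e1, e2, f0, zero_add]
  have h1 : cellCount q x ((S.erase p).filter fun j => x j < x p) (q (x p)) =
      cellRank q x S p := by
    unfold cellCount cellRank
    congr 1
    ext j
    simp only [Finset.mem_filter, Finset.mem_erase]
    constructor
    · tauto
    · rintro ⟨⟨h1, h2⟩, h3⟩
      exact ⟨⟨⟨fun h => by simp [h] at h3, h1⟩, h3⟩, h2⟩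
  have h2 : cellCount q x ((S.erase p).filter fun j => x p ≤ x j) (q (x p)) =
      cellCount q x S (q (x p)) - 1 - cellRank q x S p := by
    have hsum : cellCount q x ((S.erase p).filter fun j => x j < x p) (q (x p)) +
        cellCount q x ((S.erase p).filter fun j => x p ≤ x j) (q (x p)) =
        cellCount q x S (q (x p)) - 1 := by
      have e : (S.filter fun j => q (x j) = q (x p)).erase p =
          (S.erase p).filter fun j => q (x j) = q (x p) := by
        rw [Finset.filter_erase]
      unfold cellCount
      rw [← Finset.card_erase_of_mem (show p ∈ S.filter fun j => q (x j) = q (x p) by simp [hp]),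
        e, Finset.filter_comm, Finset.filter_comm (fun j => x p ≤ x j)]
      simp only [← not_lt]
      exact Finset.card_filter_add_card_filter_not _
    omega
  rw [← Finset.add_sum_erase R _ hR, ← Finset.add_sum_erase R _ hR,
    ← Finset.add_sum_erase R _ hR, ← Finset.sum_congr rfl hother, Finset.sum_add_distrib, h1, h2,
    splitDefect]
  ring

end Cells

/-! ### Expectations over the pivot choices -/

theorem tsum_bind_mul {α β : Type*} (P : PMF α) (f : α → PMF β) (g : β → ℝ≥0∞) :
    ∑' z, P.bind f z * g z = ∑' a, P a * ∑' z, f a z * g z := by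
  simp only [PMF.bind_apply, ← ENNReal.tsum_mul_right, ← ENNReal.tsum_mul_left]
  rw [ENNReal.tsum_comm]
  simp only [mul_assoc]

theorem tsum_pure_mul {β : Type*} (b : β) (g : β → ℝ≥0∞) :
    ∑' z, PMF.pure b z * g z = g b := by
  rw [tsum_eq_single b]
  · simp
  · intro z hz; simp [PMF.pure_apply, hz]

theorem tsum_map_mul {α β : Type*} (P : PMF α) (f : α → β) (g : β → ℝ≥0∞) :
    ∑' z, P.map f z * g z = ∑' a, P a * g (f a) := by
  simp only [PMF.map, tsum_bind_mul, Function.comp_apply, tsum_pure_mul]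

theorem tsum_const_add_mul {α : Type*} (P : PMF α) (c : ℝ≥0∞) (g : α → ℝ≥0∞) :
    ∑' z, P z * (c + g z) = c + ∑' z, P z * g z := by
  simp only [mul_add, ENNReal.tsum_add, ENNReal.tsum_mul_right, P.tsum_coe, one_mul]

/-- The total cost is additive in the cost of a comparison. -/
theorem map_quicksortCost {ι M M' : Type*} [DecidableEq ι] [AddCommMonoid M] [AddCommMonoid M']
    (key : ι → ℝ) (cost : ℝ → ℝ → M) (φ : M →+ M') (S : Finset ι) :
    (quicksortCost key cost S).map φ = quicksortCost key (fun s t => φ (cost s t)) S := by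
  induction hn : S.card using Nat.strong_induction_on generalizing S with
  | _ n ih =>
    subst hn
    rw [quicksortCost, quicksortCost]
    by_cases h : S.Nonempty
    · rw [dif_pos h, dif_pos h]
      have key (p : S) (F : ι → Prop) [DecidablePred F] :
          ((S.erase p).filter F).card < S.card :=
        lt_of_le_of_lt (Finset.card_filter_le _ _) (Finset.card_erase_lt_of_mem p.2)
      simp only [PMF.map_bind, PMF.pure_map]
      congr 1
      funext p
      rw [← ih _ (key p _) _ rfl, ← ih _ (key p _) _ rfl, PMF.bind_map]
      congr 1
      funext a
      simp [PMF.bind_map, Function.comp_def]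
    · rw [dif_neg h, dif_neg h, PMF.pure_map, map_zero]

/-! ### Dyadic levels and the second moment for fixed keys -/

/-- The index of the dyadic interval of length `2 ^ (-k)` that contains `y`. -/
noncomputable def dyadicCell (k : ℕ) (y : ℝ) : ℕ := ⌊y * 2 ^ k⌋₊

theorem monotone_dyadicCell (k : ℕ) : Monotone (dyadicCell k) := fun _ _ h =>
  Nat.floor_mono (mul_le_mul_of_nonneg_right h (by positivity))

theorem dyadicCell_lt (k : ℕ) {y : ℝ} (hy : y ∈ Set.Ico (0 : ℝ) 1) : dyadicCell k y < 2 ^ k := by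
  rw [dyadicCell, Nat.floor_lt (mul_nonneg hy.1 (by positivity))]
  push_cast
  exact mul_lt_of_lt_one_left (by positivity) hy.2

section Levels

variable {ι : Type*}

/-- The sum of `f` over the occupancies of the dyadic intervals of level `k`. -/
noncomputable def levelSum (f : ℕ → ℝ) (k : ℕ) (x : ι → ℝ) (S : Finset ι) : ℝ :=
  ∑ c ∈ Finset.range (2 ^ k), f (cellCount (dyadicCell k) x S c)

/-- Ordered pairs, as a real number. -/
def orderedPairs (n : ℕ) : ℝ := n * (n - 1)

theorem orderedPairs_nonneg (n : ℕ) : 0 ≤ orderedPairs n := by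
  rcases n with _ | n
  · simp [orderedPairs]
  · rw [orderedPairs]; push_cast; simp; positivity

/-- A weighted count of the pairs of keys in common dyadic intervals, which dominates the
variance of the cost for fixed keys. -/
noncomputable def pairWeight (L : ℕ) (x : ι → ℝ) (S : Finset ι) : ℝ :=
  ∑ k ∈ Finset.range L, (3 / 2 : ℝ) ^ k * levelSum orderedPairs k x S

theorem levelSum_nonneg {f : ℕ → ℝ} (hf : ∀ n, 0 ≤ f n) (k : ℕ) (x : ι → ℝ) (S : Finset ι) :
    0 ≤ levelSum f k x S := Finset.sum_nonneg fun _ _ => hf _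

theorem pairWeight_nonneg (L : ℕ) (x : ι → ℝ) (S : Finset ι) : 0 ≤ pairWeight L x S :=
  Finset.sum_nonneg fun _ _ => mul_nonneg (by positivity)
    (levelSum_nonneg orderedPairs_nonneg _ _ _)

/-- The excess of the mean cost, given that `p` is the first pivot, at level `k`. -/
noncomputable def pivotDeviation (k : ℕ) (x : ι → ℝ) (S : Finset ι) (p : ι) : ℝ :=
  ((cellCount (dyadicCell k) x S (dyadicCell k (x p)) : ℝ) - 1) +
    splitDefect meanKey (cellCount (dyadicCell k) x S (dyadicCell k (x p)))
      (cellRank (dyadicCell k) x S p)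

theorem sum_pivotDeviation {x : ι → ℝ} {S : Finset ι} (hx : Set.InjOn x S)
    (hI : ∀ i ∈ S, x i ∈ Set.Ico (0 : ℝ) 1) (k : ℕ) :
    ∑ p ∈ S, pivotDeviation k x S p = 0 := by
  have := sum_cellRank (q := dyadicCell k) hx
    (fun i hi => Finset.mem_range.2 (dyadicCell_lt k (hI i hi)))
    fun n r => ((n : ℝ) - 1) + splitDefect meanKey n r
  simp only [pivotDeviation]
  rw [this]
  exact Finset.sum_eq_zero fun c _ => sum_splitDefect_meanKey _

/-- The defects of the pair count sum to -n(n - 1)(n + 4)/3, so the left side is -375 n(n - 1). Here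
75 = 3 · 5², with 3 from the weighted Cauchy–Schwarz inequality and 5 from
`abs_toll_add_splitDefect_le`; 225 = 3 · 75 offsets the factor 1/3. -/
theorem sum_splitDefect_orderedPairs_add_le (n : ℕ) :
    ∑ r ∈ Finset.range n, (225 * splitDefect orderedPairs n r + 75 * ((n : ℝ) - 1) ^ 2) ≤ 0 := by
  rw [Finset.sum_add_distrib, ← Finset.mul_sum, sum_splitDefect]
  simp only [orderedPairs]
  rw [two_mul_sum_pairs]
  simp only [Finset.sum_const, Finset.card_range, nsmul_eq_mul]
  have h := orderedPairs_nonneg n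
  rw [orderedPairs] at h
  nlinarith

theorem sum_variance_step_le {x : ι → ℝ} {S : Finset ι} (hx : Set.InjOn x S)
    (hI : ∀ i ∈ S, x i ∈ Set.Ico (0 : ℝ) 1) (k : ℕ) :
    ∑ p ∈ S, (225 * splitDefect orderedPairs
        (cellCount (dyadicCell k) x S (dyadicCell k (x p))) (cellRank (dyadicCell k) x S p) +
      3 * pivotDeviation k x S p ^ 2) ≤ 0 := by
  have h1 := sum_cellRank (q := dyadicCell k) hx
    (fun i hi => Finset.mem_range.2 (dyadicCell_lt k (hI i hi)))
    fun n r => 225 * splitDefect orderedPairs n r + 75 * ((n : ℝ) - 1) ^ 2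
  have h2 : ∑ c ∈ Finset.range (2 ^ k),
      ∑ r ∈ Finset.range (cellCount (dyadicCell k) x S c),
        (225 * splitDefect orderedPairs (cellCount (dyadicCell k) x S c) r +
          75 * ((cellCount (dyadicCell k) x S c : ℝ) - 1) ^ 2) ≤ 0 :=
    Finset.sum_nonpos fun c _ => sum_splitDefect_orderedPairs_add_le _
  refine le_trans (Finset.sum_le_sum fun p hp => ?_) (h1.trans_le h2)
  have h3 := abs_le.1 (abs_toll_add_splitDefect_le (cellRank_lt (q := dyadicCell k) (x := x) hp))
  have h4 : pivotDeviation k x S p ^ 2 ≤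
      25 * ((cellCount (dyadicCell k) x S (dyadicCell k (x p)) : ℝ) - 1) ^ 2 := by
    rw [pivotDeviation]; nlinarith
  linarith

/-- Cauchy–Schwarz, with ∑ (2/3)^k ≤ 3. The ratio 3/2 is above 1, so that the dual weights are
summable, and below 2, so that bounds of order 2^(-k) remain summable against it. -/
theorem sum_sq_le_weighted (L : ℕ) (y : ℕ → ℝ) :
    (∑ k ∈ Finset.range L, y k) ^ 2 ≤ 3 * ∑ k ∈ Finset.range L, (3 / 2 : ℝ) ^ k * y k ^ 2 := by
  have h1 : (∑ k ∈ Finset.range L, y k) ^ 2 ≤ (∑ k ∈ Finset.range L, (2 / 3 : ℝ) ^ k) *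
      ∑ k ∈ Finset.range L, (3 / 2 : ℝ) ^ k * y k ^ 2 := by
    refine Finset.sum_sq_le_sum_mul_sum_of_sq_le_mul _ (fun k _ => by positivity)
      (fun k _ => by positivity) fun k _ => ?_
    rw [← mul_assoc, ← mul_pow]
    norm_num
  refine h1.trans (mul_le_mul_of_nonneg_right ?_ (Finset.sum_nonneg fun k _ => by positivity))
  rw [geom_sum_eq (by norm_num), div_le_iff_of_neg (by norm_num)]
  have : (0 : ℝ) ≤ (2 / 3) ^ L := by positivity
  linarith

variable [DecidableEq ι]

theorem levelSum_split (f : ℕ → ℝ) (f0 : f 0 = 0) (k : ℕ) {x : ι → ℝ} {S : Finset ι} {p : ι}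
    (hp : p ∈ S) (hI : x p ∈ Set.Ico (0 : ℝ) 1) :
    levelSum f k x ((S.erase p).filter fun j => x j < x p) +
      levelSum f k x ((S.erase p).filter fun j => x p ≤ x j) =
    levelSum f k x S + splitDefect f (cellCount (dyadicCell k) x S (dyadicCell k (x p)))
      (cellRank (dyadicCell k) x S p) :=
  sum_cellCount_split (monotone_dyadicCell k) f f0 hp (Finset.mem_range.2 (dyadicCell_lt k hI))

/-- The number of levels `k < L` at which two keys share a dyadic interval. -/
noncomputable def commonLevels (L : ℕ) (s t : ℝ) : ℕ :=
  ((Finset.range L).filter fun k => dyadicCell k s = dyadicCell k t).card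

theorem sum_commonLevels (L : ℕ) (x : ι → ℝ) {S : Finset ι} {p : ι} (hp : p ∈ S) :
    ((∑ j ∈ S.erase p, commonLevels L (x p) (x j) : ℕ) : ℝ) =
      ∑ k ∈ Finset.range L,
        ((cellCount (dyadicCell k) x S (dyadicCell k (x p)) : ℝ) - 1) := by
  have h1 : ∑ j ∈ S.erase p, commonLevels L (x p) (x j) = ∑ k ∈ Finset.range L,
      ((S.erase p).filter fun j => dyadicCell k (x p) = dyadicCell k (x j)).card := by
    simp only [commonLevels, Finset.card_filter]
    exact Finset.sum_comm
  rw [h1, Nat.cast_sum]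
  refine Finset.sum_congr rfl fun k _ => ?_
  have h2 : p ∈ S.filter fun j => dyadicCell k (x j) = dyadicCell k (x p) := by simp [hp]
  have h3 : ((S.erase p).filter fun j => dyadicCell k (x p) = dyadicCell k (x j)) =
      (S.filter fun j => dyadicCell k (x j) = dyadicCell k (x p)).erase p := by
    rw [← Finset.filter_erase]
    simp only [eq_comm]
  rw [h3, Finset.card_erase_of_mem h2, cellCount,
    Nat.cast_sub (Finset.card_pos.2 ⟨p, h2⟩), Nat.cast_one]

/-- The centre `t` is free because the recursion on one side must absorb the toll and the cost of
the other side. The potential and the squared offset are both carried through the split, and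
averaging over the pivot closes the induction. The same freedom later allows a centre that does not
depend on the keys. -/
theorem tsum_quicksortCost_sq_le (x : ι → ℝ) (cost : ℝ → ℝ → ℕ) (L : ℕ) (S : Finset ι)
    (hx : Set.InjOn x S) (hI : ∀ i ∈ S, x i ∈ Set.Ico (0 : ℝ) 1)
    (hc : ∀ i ∈ S, ∀ j ∈ S, i ≠ j → cost (x i) (x j) = commonLevels L (x i) (x j)) (t : ℝ) :
    ∑' z, quicksortCost x cost S z * ENNReal.ofReal (((z : ℝ) - t) ^ 2) ≤
      ENNReal.ofReal (225 * pairWeight L x S +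
        (∑ k ∈ Finset.range L, levelSum meanKey k x S - t) ^ 2) := by
  induction hn : S.card using Nat.strong_induction_on generalizing S t with
  | _ n ih =>
    subst hn
    by_cases h : S.Nonempty
    swap
    · rw [quicksortCost, dif_neg h, tsum_pure_mul]
      refine ENNReal.ofReal_le_ofReal ?_
      have := pairWeight_nonneg L x S
      have e : ∀ k, levelSum meanKey k x S = 0 := fun k => by
        rw [Finset.not_nonempty_iff_eq_empty] at h
        simp [h, levelSum, cellCount]
      simp only [e, Finset.sum_const_zero]
      push_cast
      linarith
    have : Nonempty S := h.to_subtype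
    set m : Finset ι → ℝ := fun S => ∑ k ∈ Finset.range L, levelSum meanKey k x S with hm
    set E : ι → ℝ := fun p => ∑ k ∈ Finset.range L, (3 / 2 : ℝ) ^ k * splitDefect orderedPairs
        (cellCount (dyadicCell k) x S (dyadicCell k (x p))) (cellRank (dyadicCell k) x S p) with hE
    set D : ι → ℝ := fun p => ∑ k ∈ Finset.range L, pivotDeviation k x S p with hD
    have hpw (p : S) : pairWeight L x ((S.erase (p : ι)).filter fun j => x j < x p) +
        pairWeight L x ((S.erase (p : ι)).filter fun j => x p ≤ x j) =
        pairWeight L x S + E p := by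
      simp only [pairWeight, hE, ← Finset.sum_add_distrib, ← mul_add]
      refine Finset.sum_congr rfl fun k _ => ?_
      rw [levelSum_split orderedPairs (by simp [orderedPairs]) k p.2 (hI _ p.2)]
    have inner (p : S) : ∑' z, ((quicksortCost x cost
          ((S.erase (p : ι)).filter fun j => x j < x p)).bind fun a =>
        (quicksortCost x cost ((S.erase (p : ι)).filter fun j => x p ≤ x j)).bind fun b =>
          PMF.pure ((∑ j ∈ S.erase (p : ι), cost (x p) (x j)) + a + b)) z *
            ENNReal.ofReal (((z : ℝ) - t) ^ 2) ≤
        ENNReal.ofReal (225 * (pairWeight L x S + E p) + (m S + D p - t) ^ 2) := by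
      have hsub (F : ι → Prop) [DecidablePred F] : (S.erase (p : ι)).filter F ⊆ S :=
        (Finset.filter_subset _ _).trans (Finset.erase_subset _ _)
      have hlt (F : ι → Prop) [DecidablePred F] :
          ((S.erase p).filter F).card < S.card :=
        lt_of_le_of_lt (Finset.card_filter_le _ _) (Finset.card_erase_lt_of_mem p.2)
      have IH (F : ι → Prop) [DecidablePred F] (t : ℝ) := ih _ (hlt F) ((S.erase p).filter F)
        (hx.mono (Finset.coe_subset.2 (hsub F))) (fun i hi => hI i (hsub F hi))
        (fun i hi j hj => hc i (hsub F hi) j (hsub F hj)) t rfl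
      set A := (S.erase (p : ι)).filter fun j => x j < x p with hA
      set B := (S.erase (p : ι)).filter fun j => x p ≤ x j with hB
      set T : ℕ := ∑ j ∈ S.erase (p : ι), cost (x p) (x j) with hT
      have hTD : (T : ℝ) = ∑ k ∈ Finset.range L,
          ((cellCount (dyadicCell k) x S (dyadicCell k (x p)) : ℝ) - 1) := by
        rw [← sum_commonLevels L x p.2, hT]
        congr 1
        exact Finset.sum_congr rfl fun j hj => hc _ p.2 _ (Finset.mem_of_mem_erase hj)
          (Finset.ne_of_mem_erase hj).symm
      have hmm : m A + m B + T = m S + D p := by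
        simp only [hm, hD, hTD, pivotDeviation, ← Finset.sum_add_distrib]
        refine Finset.sum_congr rfl fun k _ => ?_
        rw [levelSum_split meanKey meanKey_zero k p.2 (hI _ p.2)]
        ring
      have hPA := pairWeight_nonneg L x A
      have hPB := pairWeight_nonneg L x B
      rw [tsum_bind_mul]
      -- The right subarray is integrated first, with the left cost `a` frozen and moved into the
      -- centre; its potential is a constant for the remaining integration over `a`.
      calc _ ≤ ∑' a, quicksortCost x cost A a * (ENNReal.ofReal (225 * pairWeight L x B) +
              ENNReal.ofReal (((a : ℝ) - (t - T - m B)) ^ 2)) := by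
            refine ENNReal.tsum_le_tsum fun a => mul_le_mul_right ?_ _
            rw [tsum_bind_mul]
            simp only [tsum_pure_mul]
            have := IH (fun j => x p ≤ x j) (t - T - a)
            rw [ENNReal.ofReal_add (by positivity) (by positivity)] at this
            refine le_trans (le_of_eq ?_) (this.trans (le_of_eq ?_))
            · refine tsum_congr fun b => ?_
              congr 3
              push_cast
              ring
            · congr 2
              simp only [hm]
              ring
        _ ≤ ENNReal.ofReal (225 * pairWeight L x B) + ENNReal.ofReal (225 * pairWeight L x A +
              (m A - (t - T - m B)) ^ 2) := by
            rw [tsum_const_add_mul]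
            gcongr
            exact IH (fun j => x j < x p) (t - T - m B)
        _ = _ := by
            rw [← ENNReal.ofReal_add (by positivity) (by positivity), ← hpw p, ← hmm]
            congr 1
            ring
    have hDsum : ∑ p ∈ S, D p = 0 := by
      rw [hD, Finset.sum_comm]
      exact Finset.sum_eq_zero fun k _ => sum_pivotDeviation hx hI k
    -- The drop of the potential pays for the squared deviation, level by level after the weighted
    -- Cauchy–Schwarz inequality.
    have hED : ∑ p ∈ S, (225 * E p + D p ^ 2) ≤ 0 := by
      calc _ ≤ ∑ p ∈ S, ∑ k ∈ Finset.range L, (3 / 2 : ℝ) ^ k * (225 * splitDefect orderedPairs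
              (cellCount (dyadicCell k) x S (dyadicCell k (x p)))
              (cellRank (dyadicCell k) x S p) + 3 * pivotDeviation k x S p ^ 2) := by
            refine Finset.sum_le_sum fun p _ => ?_
            have := sum_sq_le_weighted L fun k => pivotDeviation k x S p
            rw [Finset.mul_sum] at this
            simp only [hE, hD]
            rw [Finset.mul_sum]
            refine (add_le_add_right this _).trans (le_of_eq ?_)
            rw [← Finset.sum_add_distrib]
            exact Finset.sum_congr rfl fun k _ => by ring
        _ ≤ 0 := by
            rw [Finset.sum_comm]
            refine Finset.sum_nonpos fun k _ => ?_
            rw [← Finset.mul_sum]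
            exact mul_nonpos_of_nonneg_of_nonpos (by positivity) (sum_variance_step_le hx hI k)
    have hcard : (0 : ℝ) < S.card := by exact_mod_cast h.card_pos
    have hnn (p : S) : 0 ≤ 225 * (pairWeight L x S + E p) + (m S + D p - t) ^ 2 := by
      rw [← hpw]
      have := pairWeight_nonneg L x ((S.erase (p : ι)).filter fun j => x j < x p)
      have := pairWeight_nonneg L x ((S.erase (p : ι)).filter fun j => x p ≤ x j)
      positivity
    rw [quicksortCost, dif_pos h, tsum_bind_mul]
    refine (ENNReal.tsum_le_tsum fun p => mul_le_mul_right (inner p) _).trans ?_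
    simp only [PMF.uniformOfFintype_apply, Fintype.card_coe]
    rw [ENNReal.tsum_mul_left, tsum_fintype, ← ENNReal.ofReal_sum_of_nonneg fun p _ => hnn p,
      ← ENNReal.ofReal_natCast, ← ENNReal.ofReal_inv_of_pos hcard,
      ← ENNReal.ofReal_mul (by positivity)]
    refine ENNReal.ofReal_le_ofReal ?_
    rw [inv_mul_le_iff₀ hcard,
      Finset.sum_coe_sort S fun p => 225 * (pairWeight L x S + E p) + (m S + D p - t) ^ 2]
    -- The cross term is proportional to the sum of the centred deviations `D p`, hence vanishes.
    have expand : ∑ p ∈ S, (225 * (pairWeight L x S + E p) + (m S + D p - t) ^ 2) =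
        S.card * (225 * pairWeight L x S + (m S - t) ^ 2) + ∑ p ∈ S, (225 * E p + D p ^ 2) +
          2 * (m S - t) * ∑ p ∈ S, D p := by
      rw [Finset.mul_sum, ← nsmul_eq_mul, ← Finset.sum_const, ← Finset.sum_add_distrib,
        ← Finset.sum_add_distrib]
      exact Finset.sum_congr rfl fun p _ => by ring
    rw [expand, hDsum]
    linarith

end Levels

/-! ### Poisson thinning -/

section Thinning

variable {α : Type*} [MeasurableSpace α]

/-- The number of indices in each of the classes given by `g`. -/
def classCount {m n : ℕ} (g : α → ℕ) (x : Fin n → α) (c : Fin m) : ℕ :=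
  (Finset.univ.filter fun i => g (x i) = c).card

theorem measurable_classCount {m n : ℕ} {g : α → ℕ} (hg : Measurable g) :
    Measurable fun x : Fin n → α => (classCount g x : Fin m → ℕ) := by
  refine measurable_pi_lambda _ fun c => ?_
  simp only [classCount, Finset.card_filter]
  exact Finset.measurable_sum _ fun i _ => Measurable.ite
    ((hg.comp (measurable_pi_apply i)) (measurableSet_singleton _)) measurable_const
    measurable_const

/-- A single point adds one unit vector to the occupancies, so its characteristic function is the
average of the exponentials of the coordinates of `t`. -/
theorem integral_exp_class {m : ℕ} {ν : Measure α} [IsProbabilityMeasure ν] {g : α → ℕ}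
    (hg : Measurable g) (hm : ∀ᵐ y ∂ν, g y < m) (hp : ∀ c < m, ν {y | g y = c} = (m : ℝ≥0∞)⁻¹)
    (t : Fin m → ℝ) :
    ∫ y, Complex.exp ((∑ c : Fin m, (if g y = c then 1 else 0) * t c : ℝ) * Complex.I) ∂ν =
      (m : ℂ)⁻¹ * ∑ c : Fin m, Complex.exp (t c * Complex.I) := by
  have hset (c : Fin m) : MeasurableSet {y | g y = c} := hg (measurableSet_singleton _)
  have h1 : (fun y => Complex.exp
      ((∑ c : Fin m, (if g y = c then 1 else 0) * t c : ℝ) * Complex.I)) =ᵐ[ν]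
      fun y => ∑ c : Fin m, Set.indicator {y | g y = c}
        (fun _ => Complex.exp (t c * Complex.I)) y := by
    filter_upwards [hm] with y hy
    rw [Finset.sum_eq_single ⟨g y, hy⟩, Finset.sum_eq_single ⟨g y, hy⟩]
    · simp
    · intro c _ hc
      exact Set.indicator_of_notMem (fun h => hc (Fin.ext h.symm)) _
    · simp
    · intro c _ hc
      rw [if_neg fun h => hc (Fin.ext h.symm), zero_mul]
    · simp
  rw [integral_congr_ae h1, integral_finsetSum _ fun c _ =>
    (integrable_const _).indicator (hset c), Finset.mul_sum]
  refine Finset.sum_congr rfl fun c _ => ?_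
  rw [integral_indicator (hset c), setIntegral_const, measureReal_def, hp c c.2]
  simp

/-- If a Poisson number of independent points is distributed over `m` equally likely classes, then
the occupancies are independent Poisson variables. -/
theorem lintegral_classCount {m : ℕ} (hm0 : m ≠ 0) {ν : Measure α} [IsProbabilityMeasure ν]
    {g : α → ℕ} (hg : Measurable g) (hm : ∀ᵐ y ∂ν, g y < m)
    (hp : ∀ c < m, ν {y | g y = c} = (m : ℝ≥0∞)⁻¹) (lam : ℝ≥0) (G : (Fin m → ℕ) → ℝ≥0∞) :
    ∫⁻ n, ∫⁻ x : Fin n → α, G (classCount g x) ∂(Measure.pi fun _ => ν) ∂(poissonMeasure lam) =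
      ∫⁻ c, G c ∂(Measure.pi fun _ : Fin m => poissonMeasure (lam / m)) := by
  let toReal : (Fin m → ℕ) → (Fin m → ℝ) := fun c i => (c i : ℝ)
  have hmr : Measurable toReal := measurable_of_countable _
  let κ : Kernel ℕ (Fin m → ℝ) := Kernel.ofFunOfCountable fun n =>
    (Measure.pi fun _ : Fin n => ν).map fun x => toReal (classCount g x)
  have hκm (n : ℕ) : Measurable fun x : Fin n → α => toReal (classCount g x) :=
    hmr.comp (measurable_classCount hg)
  have hκ : IsMarkovKernel κ := ⟨fun n => Measure.isProbabilityMeasure_map (hκm n).aemeasurable⟩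
  -- Equality of laws is checked on characteristic functions: `n` points give z^n, the Poisson
  -- mixture gives exp(lam (z - 1)), and this factors over the classes because z is an average.
  have key : κ ∘ₘ poissonMeasure lam =
      Measure.pi fun _ : Fin m => (poissonMeasure (lam / m)).map (Nat.cast : ℕ → ℝ) := by
    refine charFun_eq_pi_iff.1 fun t => ?_
    simp only [charFun_map_cast_poissonMeasure]
    rw [charFun_apply, integral_map (by fun_prop) (by fun_prop)]
    have hint : Integrable (fun x : Fin m → ℝ =>
        Complex.exp ((inner ℝ (WithLp.toLp 2 x) t : ℝ) * Complex.I))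
        (κ ∘ₘ poissonMeasure lam) := by
      refine Integrable.of_bound (C := 1) (by fun_prop) (ae_of_all _ fun x => ?_)
      rw [Complex.norm_exp_ofReal_mul_I]
    rw [Measure.comp_eq_comp_const_apply] at hint ⊢
    rw [Kernel.integral_comp hint]
    simp only [Kernel.const_apply]
    have h1 (n : ℕ) : ∫ y, Complex.exp ((inner ℝ (WithLp.toLp 2 y) t : ℝ) * Complex.I) ∂κ n =
        ((m : ℂ)⁻¹ * ∑ c : Fin m, Complex.exp (t c * Complex.I)) ^ n := by
      have e : κ n = (Measure.pi fun _ : Fin n => ν).map fun x => toReal (classCount g x) := rfl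
      rw [e, integral_map (hκm n).aemeasurable (by fun_prop), ← integral_exp_class hg hm hp,
        ← Fintype.card_fin n, ← integral_fintype_prod_eq_pow, Fintype.card_fin]
      congr 1
      funext x
      rw [← Complex.exp_sum, ← Finset.sum_mul, ← Complex.ofReal_sum, Finset.sum_comm]
      congr 3
      simp only [PiLp.inner_apply, toReal, classCount, Finset.card_filter]
      refine Finset.sum_congr rfl fun c _ => ?_
      simp [← Finset.sum_filter, mul_comm]
    simp only [h1]
    rw [integral_poissonMeasure, ← Complex.exp_sum]
    set z : ℂ := (m : ℂ)⁻¹ * ∑ c : Fin m, Complex.exp (t c * Complex.I) with hz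
    have h2 : ∀ n : ℕ, (Real.exp (-lam) * (lam : ℝ) ^ n / (n.factorial : ℝ)) • z ^ n =
        Complex.exp (-lam) * ((lam * z) ^ n / (n.factorial : ℂ)) := fun n => by
      rw [Complex.real_smul]
      push_cast
      rw [mul_pow]
      ring
    simp only [h2]
    rw [tsum_mul_left, ← NormedSpace.exp_eq_tsum_div (𝔸 := ℂ) |> congrFun <| (lam * z),
      ← Complex.exp_eq_exp_ℂ, ← Complex.exp_add]
    congr 1
    rw [hz]
    push_cast
    simp only [mul_sub, Finset.sum_sub_distrib, ← Finset.mul_sum]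
    generalize ∑ c : Fin m, Complex.exp (t c * Complex.I) = w
    have : (m : ℂ) ≠ 0 := by exact_mod_cast hm0
    simp
    field_simp
    ring
  -- The occupancies were embedded in a real vector space for characteristic functions; the floor
  -- recovers them.
  have hback (c : Fin m → ℕ) : (fun i => ⌊toReal c i⌋₊) = c := by
    funext i; simp [toReal]
  have hGm : Measurable fun c : Fin m → ℝ => G fun i => ⌊c i⌋₊ :=
    (measurable_of_countable G).comp (measurable_pi_lambda _ fun i =>
      Nat.measurable_floor.comp (measurable_pi_apply i))
  have e1 := Measure.lintegral_bind (m := poissonMeasure lam) κ.measurable.aemeasurable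
    hGm.aemeasurable
  have e2 : ((Measure.pi fun _ : Fin m => poissonMeasure (lam / m)).map toReal) =
      Measure.pi fun _ : Fin m => (poissonMeasure (lam / m)).map (Nat.cast : ℕ → ℝ) :=
    Measure.pi_map_pi fun _ => (measurable_of_countable _).aemeasurable
  change ∫⁻ c, _ ∂(κ ∘ₘ poissonMeasure lam) = _ at e1
  rw [key, ← e2, lintegral_map hGm hmr] at e1
  simp only [hback] at e1
  rw [e1]
  refine lintegral_congr fun n => ?_
  have e : κ n = (Measure.pi fun _ : Fin n => ν).map fun x => toReal (classCount g x) := rfl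
  rw [e, lintegral_map hGm (hκm n)]
  simp only [hback]

end Thinning

/-! ### Poisson moments -/

theorem lintegral_poissonMeasure (mu : ℝ≥0) (f : ℕ → ℝ≥0∞) :
    ∫⁻ n, f n ∂(poissonMeasure mu) =
      ∑' n : ℕ, f n * ENNReal.ofReal (Real.exp (-mu) * mu ^ n / n.factorial) := by
  rw [lintegral_countable']
  simp only [poissonMeasure_singleton]

/-- The shift n · μ^n / n! = μ · μ^(n-1) / (n-1)!; iterated, it gives all factorial moments. -/
theorem lintegral_nat_mul_poissonMeasure (mu : ℝ≥0) (f : ℕ → ℝ≥0∞) :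
    ∫⁻ n, n * f n ∂(poissonMeasure mu) = mu * ∫⁻ n, f (n + 1) ∂(poissonMeasure mu) := by
  rw [lintegral_poissonMeasure, lintegral_poissonMeasure, ← ENNReal.tsum_mul_left,
    tsum_eq_zero_add' ENNReal.summable]
  simp only [Nat.cast_zero, zero_mul, zero_add]
  refine tsum_congr fun n => ?_
  have h : ((n + 1 : ℕ) : ℝ≥0∞) * ENNReal.ofReal (Real.exp (-mu) * mu ^ (n + 1) /
      (n + 1).factorial) = mu * ENNReal.ofReal (Real.exp (-mu) * mu ^ n / n.factorial) := by
    rw [← ENNReal.ofReal_natCast, ← ENNReal.ofReal_mul (by positivity),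
      ← ENNReal.ofReal_coe_nnreal, ← ENNReal.ofReal_mul (by positivity)]
    congr 1
    have : ((n : ℝ) + 1) ≠ 0 := by positivity
    rw [Nat.factorial_succ, pow_succ]
    push_cast
    field_simp
  calc _ = f (n + 1) * (((n + 1 : ℕ) : ℝ≥0∞) * ENNReal.ofReal (Real.exp (-mu) * mu ^ (n + 1) /
      (n + 1).factorial)) := by ring
    _ = _ := by rw [h]; ring

theorem lintegral_descFactorial_poissonMeasure (mu : ℝ≥0) (k : ℕ) :
    ∫⁻ n, (n.descFactorial k : ℝ≥0∞) ∂(poissonMeasure mu) = (mu : ℝ≥0∞) ^ k := by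
  induction k with
  | zero => simp
  | succ k ih =>
    have h : ∀ n : ℕ, (n.descFactorial (k + 1) : ℝ≥0∞) = n * ((n - 1).descFactorial k : ℕ) := by
      intro n
      rcases n with _ | n
      · simp
      · rw [Nat.succ_descFactorial_succ]; push_cast; simp
    simp only [h]
    rw [lintegral_nat_mul_poissonMeasure mu fun n => ((n - 1).descFactorial k : ℕ)]
    simp only [Nat.add_sub_cancel, ih]
    ring

theorem integrable_descFactorial_poissonMeasure (mu : ℝ≥0) (k : ℕ) :
    Integrable (fun n : ℕ => (n.descFactorial k : ℝ)) (poissonMeasure mu) := by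
  refine ⟨(measurable_of_countable _).aestronglyMeasurable, ?_⟩
  rw [hasFiniteIntegral_iff_enorm]
  have : ∀ n : ℕ, ‖(n.descFactorial k : ℝ)‖ₑ = (n.descFactorial k : ℝ≥0∞) := fun n => by
    rw [Real.enorm_of_nonneg (by positivity), ENNReal.ofReal_natCast]
  simp only [this, lintegral_descFactorial_poissonMeasure]
  exact ENNReal.pow_lt_top ENNReal.coe_lt_top

theorem integral_descFactorial_poissonMeasure (mu : ℝ≥0) (k : ℕ) :
    ∫ n, (n.descFactorial k : ℝ) ∂(poissonMeasure mu) = (mu : ℝ) ^ k := by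
  rw [integral_eq_lintegral_of_nonneg_ae (ae_of_all _ fun n => by positivity)
    (measurable_of_countable _).aestronglyMeasurable]
  simp only [ENNReal.ofReal_natCast, lintegral_descFactorial_poissonMeasure]
  simp

theorem lintegral_orderedPairs_poissonMeasure (mu : ℝ≥0) :
    ∫⁻ n, ENNReal.ofReal (orderedPairs n) ∂(poissonMeasure mu) = ENNReal.ofReal (mu ^ 2) := by
  have h : ∀ n : ℕ, ENNReal.ofReal (orderedPairs n) = (n.descFactorial 2 : ℝ≥0∞) := fun n => by
    rw [← ENNReal.ofReal_natCast]
    congr 1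
    rcases n with _ | n
    · simp [orderedPairs]
    · rw [Nat.descFactorial_succ, Nat.descFactorial_one, orderedPairs, Nat.add_sub_cancel]
      push_cast; ring
  simp only [h, lintegral_descFactorial_poissonMeasure]
  rw [ENNReal.ofReal_pow (by positivity), ENNReal.ofReal_coe_nnreal]

theorem integral_cubic_poissonMeasure (mu : ℝ≥0) (a b c d : ℝ) :
    Integrable (fun n : ℕ => a + b * n + c * (n : ℝ) ^ 2 + d * (n : ℝ) ^ 3) (poissonMeasure mu) ∧
    ∫ n : ℕ, (a + b * n + c * (n : ℝ) ^ 2 + d * (n : ℝ) ^ 3) ∂(poissonMeasure mu) =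
      a + b * mu + c * (mu ^ 2 + mu) + d * (mu ^ 3 + 3 * mu ^ 2 + mu) := by
  -- Powers are rewritten in falling factorials: n² = (n)₂ + (n)₁ and n³ = (n)₃ + 3(n)₂ + (n)₁.
  have e : (fun n : ℕ => a + b * n + c * (n : ℝ) ^ 2 + d * (n : ℝ) ^ 3) = fun n : ℕ =>
      ∑ k : Fin 4, ![a, b + c + d, c + 3 * d, d] k *
        (n.descFactorial k : ℝ) := by
    funext n
    have h1 : (n.descFactorial 2 : ℝ) = n * (n - 1) := by
      rw [← descPochhammer_eval_eq_descFactorial]; simp [descPochhammer_succ_right]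
    have h2 : (n.descFactorial 3 : ℝ) = n * (n - 1) * (n - 2) := by
      rw [← descPochhammer_eval_eq_descFactorial]; simp [descPochhammer_succ_right]
    rw [Fin.sum_univ_four]
    change _ = a * (n.descFactorial 0 : ℝ) + (b + c + d) * (n.descFactorial 1 : ℝ) +
      (c + 3 * d) * (n.descFactorial 2 : ℝ) + d * (n.descFactorial 3 : ℝ)
    rw [h1, h2, Nat.descFactorial_zero, Nat.descFactorial_one, Nat.cast_one]
    ring
  have hi (k : Fin 4) : Integrable (fun n : ℕ => ![a, b + c + d, c + 3 * d, d] k *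
      (n.descFactorial k : ℝ)) (poissonMeasure mu) :=
    (integrable_descFactorial_poissonMeasure mu k).const_mul _
  rw [e]
  refine ⟨integrable_finsetSum _ fun k _ => hi k, ?_⟩
  rw [integral_finsetSum _ fun k _ => hi k]
  simp only [integral_const_mul, integral_descFactorial_poissonMeasure]
  rw [Fin.sum_univ_four]
  change a * (mu : ℝ) ^ 0 + (b + c + d) * (mu : ℝ) ^ 1 + (c + 3 * d) * (mu : ℝ) ^ 2 +
    d * (mu : ℝ) ^ 3 = _
  ring

/-! ### Fluctuations of the Quicksort mean at a Poisson size -/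

/-- The crude bound by n on the square replaces a logarithm, so that squared differences of
`meanKey` are dominated by cubic polynomials with explicit Poisson means. -/
theorem harmonic_sub_one_bounds (n : ℕ) :
    0 ≤ (harmonic (n + 1) : ℝ) - 1 ∧ (harmonic (n + 1) : ℝ) - 1 ≤ n / 2 ∧
      ((harmonic (n + 1) : ℝ) - 1) ^ 2 ≤ n := by
  induction n with
  | zero => simp
  | succ n ih =>
    obtain ⟨h0, h1, h2⟩ := ih
    rw [cast_harmonic_succ]
    push_cast
    set h := (harmonic (n + 1) : ℝ) - 1 with hh
    have e : (harmonic (n + 1) : ℝ) = h + 1 := by rw [hh]; ring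
    rw [e]
    set u : ℝ := ((n : ℝ) + 1 + 1)⁻¹ with hu
    have hn : (0 : ℝ) ≤ n := by positivity
    have hu0 : 0 ≤ u := by positivity
    have hu1 : u * (n + 2) = 1 := by rw [hu]; field_simp; ring
    have hu2 : u ≤ 1 / 2 := by nlinarith
    refine ⟨by linarith, by linarith, ?_⟩
    nlinarith [mul_le_mul_of_nonneg_right h1 hu0]

theorem meanKey_sub_bounds {m n : ℕ} (h : m ≤ n) :
    0 ≤ meanKey (n + 1) - meanKey m ∧
      meanKey (n + 1) - meanKey m ≤ 2 * (n + 1 - m) * ((harmonic (n + 1) : ℝ) - 1) := by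
  induction n, h using Nat.le_induction with
  | base =>
    have := (harmonic_sub_one_bounds m).1
    rw [meanKey_succ]
    constructor <;> linarith
  | succ n hmn ih =>
    have h0 := (harmonic_sub_one_bounds n).1
    have h1 := (harmonic_sub_one_bounds (n + 1)).1
    have hm : (m : ℝ) ≤ n := by exact_mod_cast hmn
    have hu : (0 : ℝ) ≤ ((n + 1 : ℕ) + 1 : ℝ)⁻¹ := by positivity
    have hs := cast_harmonic_succ (n + 1)
    rw [meanKey_succ (n + 1)]
    refine ⟨by linarith, ?_⟩
    push_cast at *
    nlinarith

theorem meanKey_sub_sq_le_of_le {m n : ℕ} (h : m ≤ n) :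
    (meanKey (n + 1) - meanKey m) ^ 2 ≤ 4 * ((n : ℝ) + 1 - m) ^ 2 * n := by
  obtain ⟨h0, h1⟩ := meanKey_sub_bounds h
  have h2 := (harmonic_sub_one_bounds n).2.2
  calc _ ≤ (2 * (n + 1 - m) * ((harmonic (n + 1) : ℝ) - 1)) ^ 2 := pow_le_pow_left₀ h0 h1 2
    _ = 4 * ((n : ℝ) + 1 - m) ^ 2 * ((harmonic (n + 1) : ℝ) - 1) ^ 2 := by ring
    _ ≤ _ := by gcongr

theorem meanKey_sub_sq_le (m n : ℕ) :
    (meanKey n - meanKey m) ^ 2 ≤ 4 * ((n : ℝ) - m) ^ 2 * (n + m) := by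
  rcases lt_trichotomy m n with h | rfl | h
  · obtain ⟨k, rfl⟩ := Nat.exists_eq_succ_of_ne_zero (show n ≠ 0 by omega)
    refine (meanKey_sub_sq_le_of_le (show m ≤ k by omega)).trans ?_
    push_cast
    gcongr
    linarith [(Nat.cast_nonneg m : (0 : ℝ) ≤ m)]
  · simp
  · obtain ⟨k, rfl⟩ := Nat.exists_eq_succ_of_ne_zero (show m ≠ 0 by omega)
    have := meanKey_sub_sq_le_of_le (show n ≤ k by omega)
    rw [← neg_sub, neg_sq]
    refine this.trans ?_
    push_cast
    rw [show ((n : ℝ) - (k + 1)) ^ 2 = (k + 1 - n) ^ 2 by ring]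
    gcongr
    linarith [(Nat.cast_nonneg n : (0 : ℝ) ≤ n)]

theorem meanKey_sq_le (n : ℕ) : meanKey n ^ 2 ≤ 4 * (n : ℝ) ^ 2 * (n - 1) := by
  rcases n with _ | n
  · simp
  · have := meanKey_sub_sq_le_of_le (Nat.zero_le n)
    simpa using this

/-- The bound must be quadratic also as mu → 0, since it is applied to 2^k intervals of mean
lam/2^k. For mu < 1 this relies on `meanKey` vanishing at 0 and 1. -/
theorem integral_meanKey_sub_sq_le (mu : ℝ≥0) :
    Integrable (fun n => (meanKey n - meanKey ⌊mu⌋₊) ^ 2) (poissonMeasure mu) ∧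
    ∫ n, (meanKey n - meanKey ⌊mu⌋₊) ^ 2 ∂(poissonMeasure mu) ≤ 40 * (mu : ℝ) ^ 2 := by
  have key (a b c d : ℝ) (h : ∀ n : ℕ, (meanKey n - meanKey ⌊mu⌋₊) ^ 2 ≤
      a + b * n + c * (n : ℝ) ^ 2 + d * (n : ℝ) ^ 3)
      (h' : a + b * mu + c * ((mu : ℝ) ^ 2 + mu) + d * ((mu : ℝ) ^ 3 + 3 * (mu : ℝ) ^ 2 + mu) ≤
        40 * (mu : ℝ) ^ 2) :
      Integrable (fun n => (meanKey n - meanKey ⌊mu⌋₊) ^ 2) (poissonMeasure mu) ∧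
      ∫ n, (meanKey n - meanKey ⌊mu⌋₊) ^ 2 ∂(poissonMeasure mu) ≤ 40 * (mu : ℝ) ^ 2 := by
    obtain ⟨i1, i2⟩ := integral_cubic_poissonMeasure mu a b c d
    have hint : Integrable (fun n => (meanKey n - meanKey ⌊mu⌋₊) ^ 2) (poissonMeasure mu) :=
      i1.mono' (measurable_of_countable _).aestronglyMeasurable (ae_of_all _ fun n => by
        rw [Real.norm_of_nonneg (by positivity)]; exact h n)
    refine ⟨hint, ?_⟩
    exact (integral_mono hint i1 h).trans (i2.trans_le h')
  have hmu : (0 : ℝ) ≤ mu := mu.2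
  rcases lt_or_ge mu 1 with h1 | h1
  · have hf : ⌊mu⌋₊ = 0 := Nat.floor_eq_zero.2 h1
    have h1' : (mu : ℝ) ≤ 1 := by exact_mod_cast h1.le
    refine key 0 0 (-4) 4 (fun n => ?_) ?_
    · rw [hf, meanKey_zero, sub_zero]
      refine (meanKey_sq_le n).trans (le_of_eq (by ring))
    · nlinarith [mul_nonneg (sub_nonneg.2 h1') (sq_nonneg (mu : ℝ))]
  · have h1' : (1 : ℝ) ≤ mu := by exact_mod_cast h1
    -- These are the coefficients of 8((n - mu)² + 1)(n + mu), whose mean 16 mu² + 24 mu is at most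
    -- 40 mu² for mu ≥ 1.
    refine key (8 * (mu : ℝ) ^ 3 + 8 * mu) (8 - 8 * (mu : ℝ) ^ 2) (-8 * mu) 8 (fun n => ?_) ?_
    · refine (meanKey_sub_sq_le _ n).trans ?_
      have f1 : ((⌊mu⌋₊ : ℕ) : ℝ) ≤ mu := by exact_mod_cast Nat.floor_le mu.2
      have f2 : (mu : ℝ) < (⌊mu⌋₊ : ℕ) + 1 := by exact_mod_cast Nat.lt_floor_add_one mu
      set m : ℝ := ((⌊mu⌋₊ : ℕ) : ℝ)
      have hm : 0 ≤ m := by positivity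
      have hn : (0 : ℝ) ≤ n := by positivity
      calc 4 * ((n : ℝ) - m) ^ 2 * (n + m) ≤ 4 * (2 * ((n : ℝ) - mu) ^ 2 + 2) * (n + mu) := by
            have : ((n : ℝ) - m) ^ 2 ≤ 2 * ((n : ℝ) - mu) ^ 2 + 2 := by
              nlinarith [sq_nonneg (((n : ℝ) - mu) - (mu - m))]
            gcongr
        _ = _ := by ring
    · nlinarith

/-- The mean number of key comparisons for a Poisson number of keys. -/
noncomputable def poissonMeanKey (mu : ℝ≥0) : ℝ := ∫ n, meanKey n ∂(poissonMeasure mu)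

theorem memLp_meanKey (mu : ℝ≥0) : MemLp meanKey 2 (poissonMeasure mu) := by
  have h : MemLp (fun n => meanKey n - meanKey ⌊mu⌋₊) 2 (poissonMeasure mu) :=
    (memLp_two_iff_integrable_sq (measurable_of_countable _).aestronglyMeasurable).2
      (integral_meanKey_sub_sq_le mu).1
  have e : meanKey = (fun n => meanKey n - meanKey ⌊mu⌋₊) + fun _ => meanKey ⌊mu⌋₊ := by
    funext n; simp
  rw [e]
  exact h.add (memLp_const _)

theorem variance_meanKey_le (mu : ℝ≥0) :
    Var[meanKey; poissonMeasure mu] ≤ 40 * (mu : ℝ) ^ 2 := by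
  rw [← variance_sub_const (memLp_meanKey mu).1 (meanKey ⌊mu⌋₊)]
  exact (variance_le_expectation_sq (measurable_of_countable _).aestronglyMeasurable).trans
    (integral_meanKey_sub_sq_le mu).2

/-- The square of a mean is at most the mean of the square, here 40 mu² ≤ (7 mu)². -/
theorem abs_poissonMeanKey_sub_le (mu : ℝ≥0) :
    |poissonMeanKey mu - meanKey ⌊mu⌋₊| ≤ 7 * mu := by
  have hint : Integrable meanKey (poissonMeasure mu) := (memLp_meanKey mu).integrable (by norm_num)
  have h1 : poissonMeanKey mu - meanKey ⌊mu⌋₊ =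
      ∫ n, (meanKey n - meanKey ⌊mu⌋₊) ∂(poissonMeasure mu) := by
    rw [integral_sub hint (integrable_const _)]; simp [poissonMeanKey]
  have h2 := variance_nonneg (fun n => meanKey n - meanKey ⌊mu⌋₊) (poissonMeasure mu)
  have hL : MemLp (fun n => meanKey n - meanKey ⌊mu⌋₊) 2 (poissonMeasure mu) :=
    (memLp_meanKey mu).sub (memLp_const _)
  rw [variance_eq_sub hL, ← h1] at h2
  have h3 := (integral_meanKey_sub_sq_le mu).2
  refine abs_le_of_sq_le_sq ?_ (by positivity)
  simp only [Pi.pow_apply] at h2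
  nlinarith [sq_nonneg (mu : ℝ)]

theorem poissonMeanKey_nonneg (mu : ℝ≥0) : 0 ≤ poissonMeanKey mu :=
  integral_nonneg fun n => by
    rcases n with _ | n
    · simp
    · simpa using (meanKey_sub_bounds (Nat.zero_le n)).1

/-- `meanKey n` is at most n(n - 1), whose Poisson mean is mu². This controls the fine levels, where
the intervals are nearly empty. -/
theorem poissonMeanKey_le_sq (mu : ℝ≥0) : poissonMeanKey mu ≤ (mu : ℝ) ^ 2 := by
  have hint : Integrable meanKey (poissonMeasure mu) := (memLp_meanKey mu).integrable (by norm_num)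
  obtain ⟨i1, i2⟩ := integral_cubic_poissonMeasure mu 0 (-1) 1 0
  refine (integral_mono hint i1 fun n => ?_).trans (i2.trans_le (le_of_eq (by ring)))
  rcases n with _ | n
  · simp
  · have h1 := (meanKey_sub_bounds (Nat.zero_le n)).2
    have h2 := (harmonic_sub_one_bounds n).2.1
    have hn : (0 : ℝ) ≤ n := by positivity
    simp only [meanKey_zero, Nat.cast_zero, sub_zero] at h1
    push_cast
    nlinarith

/-! ### Binary digits and dyadic intervals -/

theorem dyadicCell_succ_div (k : ℕ) (y : ℝ) : dyadicCell (k + 1) y / 2 = dyadicCell k y := by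
  have h := Nat.floor_div_natCast (y * 2 ^ (k + 1)) 2
  rw [dyadicCell, dyadicCell, ← h]
  congr 1
  push_cast
  rw [pow_succ]
  ring

theorem digits_eq_iff (k : ℕ) (s t : ℝ) :
    Real.digits s 2 k = Real.digits t 2 k ↔
      dyadicCell (k + 1) s % 2 = dyadicCell (k + 1) t % 2 := by
  simp [Real.digits, dyadicCell, Fin.ext_iff, Fin.ofNat]

theorem dyadicCell_eq_iff {s t : ℝ} (hs : s ∈ Set.Ico (0 : ℝ) 1) (ht : t ∈ Set.Ico (0 : ℝ) 1)
    (k : ℕ) : dyadicCell k s = dyadicCell k t ↔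
      ∀ i < k, Real.digits s 2 i = Real.digits t 2 i := by
  induction k with
  | zero =>
    have h1 := dyadicCell_lt 0 hs
    have h2 := dyadicCell_lt 0 ht
    simp only [not_lt_zero, IsEmpty.forall_iff, implies_true, iff_true]
    omega
  | succ k ih =>
    rw [Nat.forall_lt_succ_right, ← ih, digits_eq_iff, ← dyadicCell_succ_div k s,
      ← dyadicCell_succ_div k t]
    omega

theorem exists_dyadicCell_ne {s t : ℝ} (hs : 0 ≤ s) (ht : 0 ≤ t) (h : s ≠ t) :
    ∃ k, dyadicCell k s ≠ dyadicCell k t := by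
  by_contra! hcon
  obtain ⟨k, hk⟩ := pow_unbounded_of_one_lt (|s - t|⁻¹) (show (1 : ℝ) < 2 by norm_num)
  have hd : 0 < |s - t| := abs_pos.2 (sub_ne_zero.2 h)
  have h1 : 1 < |s - t| * 2 ^ k := by
    rwa [inv_lt_iff_one_lt_mul₀' hd] at hk
  have e := hcon k
  rw [dyadicCell, dyadicCell] at e
  have a1 := Nat.floor_le (show 0 ≤ s * 2 ^ k by positivity)
  have a2 := Nat.lt_floor_add_one (s * 2 ^ k)
  have b1 := Nat.floor_le (show 0 ≤ t * 2 ^ k by positivity)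
  have b2 := Nat.lt_floor_add_one (t * 2 ^ k)
  rw [e] at a1 a2
  have h2 : |s - t| * 2 ^ k = |s * 2 ^ k - t * 2 ^ k| := by
    rw [← sub_mul, abs_mul, abs_of_pos (show (0 : ℝ) < 2 ^ k by positivity)]
  rw [h2] at h1
  have h3 : |s * 2 ^ k - t * 2 ^ k| < 1 := abs_lt.2 ⟨by linarith, by linarith⟩
  linarith

/-- The bridge from bits to levels. `Real.digits` counts from 0 and `bitCost` from 1, so the shared
levels, level 0 included, number exactly `bitCost s t`. -/
theorem dyadicCell_eq_iff_lt_bitCost {s t : ℝ} (hs : s ∈ Set.Ico (0 : ℝ) 1)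
    (ht : t ∈ Set.Ico (0 : ℝ) 1) (h : s ≠ t) (k : ℕ) :
    dyadicCell k s = dyadicCell k t ↔ k < bitCost s t := by
  have hne : {i : ℕ | Real.digits s 2 i ≠ Real.digits t 2 i}.Nonempty := by
    obtain ⟨k, hk⟩ := exists_dyadicCell_ne hs.1 ht.1 h
    rw [Ne, dyadicCell_eq_iff hs ht] at hk
    push Not at hk
    obtain ⟨i, -, hi⟩ := hk
    exact ⟨i, hi⟩
  rw [dyadicCell_eq_iff hs ht, bitCost, Nat.lt_succ_iff]
  constructor
  · intro hk
    by_contra! hlt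
    exact Nat.sInf_mem hne (hk _ hlt)
  · intro hk i hi
    by_contra hcon
    have := Nat.sInf_le (s := {i : ℕ | Real.digits s 2 i ≠ Real.digits t 2 i}) hcon
    omega

theorem commonLevels_eq_bitCost {s t : ℝ} (hs : s ∈ Set.Ico (0 : ℝ) 1)
    (ht : t ∈ Set.Ico (0 : ℝ) 1) (h : s ≠ t) {L : ℕ} (hL : bitCost s t ≤ L) :
    commonLevels L s t = bitCost s t := by
  simp only [commonLevels, dyadicCell_eq_iff_lt_bitCost hs ht h]
  have : (Finset.range L).filter (fun k => k < bitCost s t) = Finset.range (bitCost s t) := by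
    ext k; simp; omega
  rw [this, Finset.card_range]

theorem commonLevels_one {s t : ℝ} (hs : s ∈ Set.Ico (0 : ℝ) 1)
    (ht : t ∈ Set.Ico (0 : ℝ) 1) : commonLevels 1 s t = 1 := by
  have h : dyadicCell 0 s = dyadicCell 0 t := (dyadicCell_eq_iff hs ht 0).2 (by simp)
  simp [commonLevels, h, Finset.filter_true_of_mem]

/-! ### Uniform keys: level sums and their moments -/

theorem unif_eq : unif = volume.restrict (Set.Ico (0 : ℝ) 1) :=
  Measure.restrict_congr_set Ioo_ae_eq_Ico

theorem ae_unif_mem_Ico : ∀ᵐ y ∂unif, y ∈ Set.Ico (0 : ℝ) 1 := by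
  rw [unif_eq]; exact ae_restrict_mem measurableSet_Ico

theorem measurable_dyadicCell (k : ℕ) : Measurable (dyadicCell k) :=
  Nat.measurable_floor.comp (measurable_id.mul_const _)

theorem unif_dyadicCell {k c : ℕ} (hc : c < 2 ^ k) :
    unif {y | dyadicCell k y = c} = ((2 ^ k : ℕ) : ℝ≥0∞)⁻¹ := by
  have hk : (0 : ℝ) < 2 ^ k := by positivity
  have hc' : (c : ℝ) + 1 ≤ 2 ^ k := by exact_mod_cast hc
  have e : {y | dyadicCell k y = c} ∩ Set.Ico (0 : ℝ) 1 =
      Set.Ico ((c : ℝ) / 2 ^ k) (((c : ℝ) + 1) / 2 ^ k) := by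
    ext y
    simp only [Set.mem_inter_iff, Set.mem_ofPred_eq, Set.mem_Ico, dyadicCell]
    rw [div_le_iff₀ hk, lt_div_iff₀ hk]
    constructor
    · rintro ⟨h, hy0, -⟩
      exact (Nat.floor_eq_iff (by positivity)).1 h
    · rintro ⟨h1, h2⟩
      have hy0 : 0 ≤ y := nonneg_of_mul_nonneg_left
        ((Nat.cast_nonneg c).trans h1) hk
      exact ⟨(Nat.floor_eq_iff (by positivity)).2 ⟨h1, h2⟩, hy0, by nlinarith⟩
  have hmeas : MeasurableSet {y | dyadicCell k y = c} :=
    measurable_dyadicCell k (measurableSet_singleton c)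
  rw [unif_eq, Measure.restrict_apply hmeas, e,
    Real.volume_Ico, ← sub_div, add_sub_cancel_left, one_div, ENNReal.ofReal_inv_of_pos hk,
    ENNReal.ofReal_pow (by norm_num)]
  simp

theorem ae_injective (n : ℕ) :
    ∀ᵐ x ∂(Measure.pi fun _ : Fin n => unif), Function.Injective x ∧
      ∀ i, x i ∈ Set.Ico (0 : ℝ) 1 := by
  have h1 : ∀ᵐ x ∂(Measure.pi fun _ : Fin n => unif), ∀ i, x i ∈ Set.Ico (0 : ℝ) 1 := by
    rw [ae_all_iff]
    intro i
    exact (measurePreserving_eval (fun _ : Fin n => unif) i).quasiMeasurePreserving.ae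
      ae_unif_mem_Ico
  have h2 : ∀ᵐ x ∂(Measure.pi fun _ : Fin n => unif), ∀ i j, i ≠ j → x i ≠ x j := by
    have e : (Measure.pi fun _ : Fin n => unif) =
        (volume : Measure (Fin n → ℝ)).restrict (Set.univ.pi fun _ => Set.Ioo (0 : ℝ) 1) := by
      rw [volume_pi, Measure.restrict_pi_pi]; rfl
    rw [e]
    refine ae_restrict_of_ae ?_
    rw [ae_all_iff]; intro i
    rw [ae_all_iff]; intro j
    by_cases hij : i = j
    · simp [hij]
    -- Coincidence of two keys confines the vector to a proper linear subspace, which is a null set.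
    have h3 := Measure.addHaar_submodule (volume : Measure (Fin n → ℝ))
      (LinearMap.ker (LinearMap.proj (R := ℝ) (φ := fun _ : Fin n => ℝ) i - LinearMap.proj j))
      (by
        intro htop
        have : (Pi.single i 1 : Fin n → ℝ) ∈ LinearMap.ker
          (LinearMap.proj (R := ℝ) (φ := fun _ : Fin n => ℝ) i - LinearMap.proj j) := by
          rw [htop]; trivial
        simp [Ne.symm hij] at this)
    rw [ae_iff]
    refine measure_mono_null (fun x hx => ?_) h3
    simp only [Set.mem_ofPred_eq, hij, not_false_eq_true, forall_const, Ne, not_not] at hx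
    simp [hx]
  filter_upwards [h1, h2] with x hx1 hx2
  refine ⟨fun i j hij => ?_, hx1⟩
  by_contra hne
  exact hx2 i j hne hij

theorem lintegral_levels (lam : ℝ≥0) (k : ℕ) (G : (Fin (2 ^ k) → ℕ) → ℝ≥0∞) :
    ∫⁻ n, ∫⁻ x : Fin n → ℝ, G (classCount (dyadicCell k) x)
      ∂(Measure.pi fun _ => unif) ∂(poissonMeasure lam) =
      ∫⁻ c, G c ∂(Measure.pi fun _ : Fin (2 ^ k) => poissonMeasure (lam / 2 ^ k)) := by
  have := lintegral_classCount (m := 2 ^ k) (by positivity) (ν := unif) (measurable_dyadicCell k)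
    (ae_unif_mem_Ico.mono fun y hy => dyadicCell_lt k hy)
    (fun c hc => unif_dyadicCell hc) lam G
  rw [this]
  push_cast
  rfl

theorem levelSum_eq_classCount (f : ℕ → ℝ) (k : ℕ) {n : ℕ} (x : Fin n → ℝ) :
    levelSum f k x Finset.univ = ∑ c : Fin (2 ^ k), f (classCount (dyadicCell k) x c) := by
  rw [levelSum, ← Fin.sum_univ_eq_sum_range fun c =>
    f (cellCount (dyadicCell k) x Finset.univ c)]
  rfl

theorem measurable_levelSum (f : ℕ → ℝ) (k n : ℕ) :
    Measurable fun x : Fin n → ℝ => levelSum f k x Finset.univ := by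
  simp only [levelSum_eq_classCount]
  exact (measurable_of_countable fun c : Fin (2 ^ k) → ℕ => ∑ i, f (c i)).comp
    (measurable_classCount (measurable_dyadicCell k))

theorem lintegral_levelSum_orderedPairs (lam : ℝ≥0) (k : ℕ) :
    ∫⁻ n, ∫⁻ x : Fin n → ℝ, ENNReal.ofReal (levelSum orderedPairs k x Finset.univ)
      ∂(Measure.pi fun _ => unif) ∂(poissonMeasure lam) =
      ENNReal.ofReal ((lam : ℝ) ^ 2 / 2 ^ k) := by
  simp only [levelSum_eq_classCount]
  rw [lintegral_levels lam k fun c => ENNReal.ofReal (∑ i, orderedPairs (c i))]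
  simp only [ENNReal.ofReal_sum_of_nonneg fun i _ => orderedPairs_nonneg _]
  rw [lintegral_finsetSum _ fun i _ => measurable_of_countable _]
  have h (i : Fin (2 ^ k)) : ∫⁻ c : Fin (2 ^ k) → ℕ, ENNReal.ofReal (orderedPairs (c i))
      ∂(Measure.pi fun _ => poissonMeasure (lam / 2 ^ k)) =
      ENNReal.ofReal (((lam / 2 ^ k : ℝ≥0) : ℝ) ^ 2) := by
    rw [← lintegral_orderedPairs_poissonMeasure]
    exact (measurePreserving_eval (fun _ : Fin (2 ^ k) => poissonMeasure (lam / 2 ^ k)) i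
      ).lintegral_comp (f := fun n => ENNReal.ofReal (orderedPairs n)) (measurable_of_countable _)
  simp only [h]
  rw [Finset.sum_const, Finset.card_univ, Fintype.card_fin, nsmul_eq_mul,
    ← ENNReal.ofReal_natCast, ← ENNReal.ofReal_mul (by positivity)]
  congr 1
  push_cast
  field_simp

/-- The mean of the sum over the dyadic intervals of level `k` of the number of comparisons of
keys in the same interval. -/
noncomputable def levelMean (lam : ℝ≥0) (k : ℕ) : ℝ := 2 ^ k * poissonMeanKey (lam / 2 ^ k)

/-- By independence the variances of the 2^k occupancy terms add, to at most 2^k · 40 (lam/2^k)². -/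
theorem lintegral_levelSum_meanKey_le (lam : ℝ≥0) (k : ℕ) :
    ∫⁻ n, ∫⁻ x : Fin n → ℝ,
      ENNReal.ofReal ((levelSum meanKey k x Finset.univ - levelMean lam k) ^ 2)
      ∂(Measure.pi fun _ => unif) ∂(poissonMeasure lam) ≤
      ENNReal.ofReal (40 * ((lam : ℝ) ^ 2 / 2 ^ k)) := by
  simp only [levelSum_eq_classCount]
  rw [lintegral_levels lam k fun c => ENNReal.ofReal ((∑ i, meanKey (c i) - levelMean lam k) ^ 2)]
  set μ : Measure (Fin (2 ^ k) → ℕ) := Measure.pi fun _ => poissonMeasure (lam / 2 ^ k) with hμ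
  have hcomp (i : Fin (2 ^ k)) : MemLp (fun c : Fin (2 ^ k) → ℕ => meanKey (c i)) 2 μ :=
    (memLp_meanKey _).comp_measurePreserving
      (measurePreserving_eval (fun _ : Fin (2 ^ k) => poissonMeasure (lam / 2 ^ k)) i)
  have hmem : MemLp (fun c : Fin (2 ^ k) → ℕ => ∑ i, meanKey (c i)) 2 μ :=
    memLp_finsetSum _ fun i _ => hcomp i
  have hmean : ∫ c, ∑ i, meanKey (c i) ∂μ = levelMean lam k := by
    rw [integral_finsetSum _ fun i _ => (hcomp i).integrable (by norm_num)]
    have h (i : Fin (2 ^ k)) : ∫ c, meanKey (c i) ∂μ = poissonMeanKey (lam / 2 ^ k) := by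
      have := (measurePreserving_eval (fun _ : Fin (2 ^ k) => poissonMeasure (lam / 2 ^ k)) i)
      rw [poissonMeanKey, ← this.map_eq, integral_map (measurable_pi_apply i).aemeasurable
        (measurable_of_countable _).aestronglyMeasurable]
    simp only [h]
    simp [levelMean]
  have hvar : Var[fun c => ∑ i, meanKey (c i); μ] ≤ 40 * ((lam : ℝ) ^ 2 / 2 ^ k) := by
    have h1 := variance_sum_pi (μ := fun _ : Fin (2 ^ k) => poissonMeasure (lam / 2 ^ k))
      (X := fun _ => meanKey) fun _ => memLp_meanKey _
    have e : (∑ i : Fin (2 ^ k), fun c : Fin (2 ^ k) → ℕ => meanKey (c i)) =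
        fun c => ∑ i, meanKey (c i) := by funext c; simp
    rw [e] at h1
    rw [h1]
    refine (Finset.sum_le_sum fun i _ => variance_meanKey_le (lam / 2 ^ k)).trans (le_of_eq ?_)
    simp
    field_simp
  rw [variance_eq_integral hmem.1.aemeasurable, hmean] at hvar
  rw [← ofReal_integral_eq_lintegral_ofReal]
  · exact ENNReal.ofReal_le_ofReal hvar
  · exact (memLp_two_iff_integrable_sq (measurable_of_countable _).aestronglyMeasurable).1
      (hmem.sub (memLp_const (levelMean lam k)))
  · exact ae_of_all _ fun c => sq_nonneg _

theorem levelMean_nonneg (lam : ℝ≥0) (k : ℕ) : 0 ≤ levelMean lam k :=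
  mul_nonneg (by positivity) (poissonMeanKey_nonneg _)

theorem levelMean_le (lam : ℝ≥0) (k : ℕ) : levelMean lam k ≤ (lam : ℝ) ^ 2 * (1 / 2) ^ k := by
  refine (mul_le_mul_of_nonneg_left (poissonMeanKey_le_sq _) (by positivity)).trans (le_of_eq ?_)
  push_cast
  rw [one_div, inv_pow]
  field_simp

theorem summable_levelMean (lam : ℝ≥0) : Summable (levelMean lam) :=
  Summable.of_nonneg_of_le (levelMean_nonneg lam) (levelMean_le lam)
    ((summable_geometric_of_lt_one (by norm_num) (by norm_num)).mul_left _)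

/-! ### Second moments of the two costs -/

theorem lintegral_costLaw_comp {n : ℕ} (x : Fin n → ℝ) (φ : ℕ × ℕ →+ ℕ) (g : ℕ → ℝ≥0∞) :
    ∫⁻ z, g (φ z) ∂(costLaw n x) =
      ∑' m, quicksortCost x (fun s t => φ ((1 : ℕ), bitCost s t)) Finset.univ m * g m := by
  rw [← map_quicksortCost, tsum_map_mul, lintegral_countable', costLaw]
  refine tsum_congr fun z => ?_
  rw [PMF.toMeasure_apply_singleton _ _ (measurableSet_singleton z), mul_comm]

theorem lintegral_poissonLaw (lam : ℝ≥0) (f : ℕ × ℕ → ℝ≥0∞) :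
    ∫⁻ z, f z ∂(poissonLaw lam) = ∫⁻ n, ∫⁻ x : Fin n → ℝ, ∫⁻ z, f z ∂(costLaw n x)
      ∂(Measure.pi fun _ => unif) ∂(poissonMeasure lam) := by
  rw [poissonLaw, Measure.lintegral_bind (measurable_of_countable _).aemeasurable
    (measurable_of_countable _).aemeasurable]
  refine lintegral_congr fun n => ?_
  rw [Measure.lintegral_bind (measurable_costLaw n).aemeasurable
    (measurable_of_countable _).aemeasurable]

theorem ofReal_tsum_sq_le {y : ℕ → ℝ} (hy : Summable y) :
    ENNReal.ofReal ((∑' k, y k) ^ 2) ≤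
      3 * ∑' k, ENNReal.ofReal ((3 / 2) ^ k) * ENNReal.ofReal (y k ^ 2) := by
  have h := ENNReal.tendsto_ofReal ((hy.hasSum.tendsto_sum_nat).pow 2)
  refine le_of_tendsto h (Eventually.of_forall fun L => ?_)
  refine (ENNReal.ofReal_le_ofReal (sum_sq_le_weighted L y)).trans ?_
  rw [ENNReal.ofReal_mul (by norm_num), ENNReal.ofReal_sum_of_nonneg fun k _ => by positivity]
  refine mul_le_mul' (by simp) ?_
  simp only [ENNReal.ofReal_mul (show (0 : ℝ) ≤ (3 / 2) ^ _ by positivity)]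
  exact ENNReal.sum_le_tsum _

theorem tsum_geometric_weight (a : ℝ) (ha : 0 ≤ a) :
    ∑' k : ℕ, ENNReal.ofReal ((3 / 2) ^ k) * ENNReal.ofReal (a / 2 ^ k) =
      ENNReal.ofReal (4 * a) := by
  have h : ∀ k : ℕ, ENNReal.ofReal ((3 / 2) ^ k) * ENNReal.ofReal (a / 2 ^ k) =
      ENNReal.ofReal (a * (3 / 4) ^ k) := fun k => by
    rw [← ENNReal.ofReal_mul (by positivity)]
    congr 1
    rw [show (3 / 4 : ℝ) = 3 / 2 / 2 by norm_num, div_pow (3 / 2 : ℝ)]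
    ring
  simp only [h]
  rw [← ENNReal.ofReal_tsum_of_nonneg (fun k => by positivity)
    ((summable_geometric_of_lt_one (by norm_num) (by norm_num)).mul_left _), tsum_mul_left,
    tsum_geometric_of_lt_one (by norm_num) (by norm_num)]
  congr 1
  norm_num
  ring

/-- The mean number of bit comparisons for a Poisson number of keys. -/
noncomputable def poissonMeanBit (lam : ℝ≥0) : ℝ := ∑' k, levelMean lam k

theorem lintegral_costLaw_bit_le {n : ℕ} {x : Fin n → ℝ} (hx : Function.Injective x)
    (hI : ∀ i, x i ∈ Set.Ico (0 : ℝ) 1) (lam : ℝ≥0) :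
    ∫⁻ z, ENNReal.ofReal ((bitComparisons z - poissonMeanBit lam) ^ 2) ∂(costLaw n x) ≤
      225 * ∑' k, ENNReal.ofReal ((3 / 2) ^ k) *
          ENNReal.ofReal (levelSum orderedPairs k x Finset.univ) +
        3 * ∑' k, ENNReal.ofReal ((3 / 2) ^ k) *
          ENNReal.ofReal ((levelSum meanKey k x Finset.univ - levelMean lam k) ^ 2) := by
  -- Any bound for all bit costs serves: from level `L` on, the keys lie in different intervals and
  -- `meanKey` vanishes on the occupancies 0 and 1.
  set L : ℕ := ∑ i, ∑ j, bitCost (x i) (x j) with hL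
  have hle (i j : Fin n) : bitCost (x i) (x j) ≤ L :=
    (Finset.single_le_sum (f := fun j => bitCost (x i) (x j)) (fun _ _ => Nat.zero_le _)
      (Finset.mem_univ j)).trans
    (Finset.single_le_sum (f := fun i => ∑ j, bitCost (x i) (x j)) (fun _ _ => Nat.zero_le _)
      (Finset.mem_univ i))
  have h1 := tsum_quicksortCost_sq_le x bitCost L Finset.univ hx.injOn (fun i _ => hI i)
    (fun i _ j _ hij => (commonLevels_eq_bitCost (hI i) (hI j) (hx.ne hij) (hle i j)).symm)
    (poissonMeanBit lam)
  have h2 := lintegral_costLaw_comp x (AddMonoidHom.snd ℕ ℕ) fun m =>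
    ENNReal.ofReal (((m : ℝ) - poissonMeanBit lam) ^ 2)
  have hz : ∀ k ∉ Finset.range L, levelSum meanKey k x Finset.univ = 0 := by
    intro k hk
    refine Finset.sum_eq_zero fun c _ => ?_
    have : cellCount (dyadicCell k) x Finset.univ c ≤ 1 := by
      rw [cellCount, Finset.card_le_one]
      intro i hi j hj
      by_contra hij
      have e : dyadicCell k (x i) = dyadicCell k (x j) :=
        (Finset.mem_filter.1 hi).2.trans (Finset.mem_filter.1 hj).2.symm
      rw [dyadicCell_eq_iff_lt_bitCost (hI i) (hI j) (hx.ne hij)] at e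
      exact hk (Finset.mem_range.2 (e.trans_le (hle i j)))
    interval_cases cellCount (dyadicCell k) x Finset.univ c <;> simp
  have hs : Summable fun k => levelSum meanKey k x Finset.univ := summable_of_ne_finset_zero hz
  have hm : ∑ k ∈ Finset.range L, levelSum meanKey k x Finset.univ - poissonMeanBit lam =
      ∑' k, (levelSum meanKey k x Finset.univ - levelMean lam k) := by
    rw [hs.tsum_sub (summable_levelMean lam), tsum_eq_sum hz, poissonMeanBit]
  refine (h2.trans_le h1).trans ?_
  have hpw := pairWeight_nonneg L x Finset.univ
  rw [ENNReal.ofReal_add (by positivity) (by positivity), hm]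
  refine add_le_add ?_ (ofReal_tsum_sq_le (hs.sub (summable_levelMean lam)))
  rw [ENNReal.ofReal_mul (by norm_num), pairWeight, ENNReal.ofReal_sum_of_nonneg fun k _ =>
    mul_nonneg (by positivity) (levelSum_nonneg orderedPairs_nonneg _ _ _)]
  refine mul_le_mul' (by simp) ?_
  simp only [ENNReal.ofReal_mul (show (0 : ℝ) ≤ (3 / 2) ^ _ by positivity)]
  exact ENNReal.sum_le_tsum _

/-- With ∑ (3/4)^k = 4, the pivots contribute 225 · 4 = 900 and the keys 3 · 4 · 40 = 480. -/
theorem lintegral_bit_le (lam : ℝ≥0) :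
    ∫⁻ z, ENNReal.ofReal ((bitComparisons z - poissonMeanBit lam) ^ 2) ∂(poissonLaw lam) ≤
      ENNReal.ofReal (1380 * (lam : ℝ) ^ 2) := by
  have hm1 (k n : ℕ) : Measurable fun x : Fin n → ℝ => ENNReal.ofReal ((3 / 2) ^ k) *
      ENNReal.ofReal (levelSum orderedPairs k x Finset.univ) :=
    (measurable_levelSum orderedPairs k n).ennreal_ofReal.const_mul _
  have hm2 (k n : ℕ) : Measurable fun x : Fin n → ℝ => ENNReal.ofReal ((3 / 2) ^ k) *
      ENNReal.ofReal ((levelSum meanKey k x Finset.univ - levelMean lam k) ^ 2) :=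
    (((measurable_levelSum meanKey k n).sub_const _).pow_const 2).ennreal_ofReal.const_mul _
  rw [lintegral_poissonLaw]
  calc _ ≤ ∫⁻ n, ∫⁻ x : Fin n → ℝ, (225 * ∑' k, ENNReal.ofReal ((3 / 2) ^ k) *
          ENNReal.ofReal (levelSum orderedPairs k x Finset.univ) +
        3 * ∑' k, ENNReal.ofReal ((3 / 2) ^ k) *
          ENNReal.ofReal ((levelSum meanKey k x Finset.univ - levelMean lam k) ^ 2))
        ∂(Measure.pi fun _ => unif) ∂(poissonMeasure lam) := by
        refine lintegral_mono fun n => lintegral_mono_ae ?_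
        filter_upwards [ae_injective n] with x hx
        exact lintegral_costLaw_bit_le hx.1 hx.2 lam
    _ = 225 * ∑' k, ENNReal.ofReal ((3 / 2) ^ k) * (∫⁻ n, ∫⁻ x : Fin n → ℝ,
          ENNReal.ofReal (levelSum orderedPairs k x Finset.univ)
            ∂(Measure.pi fun _ => unif) ∂(poissonMeasure lam)) +
        3 * ∑' k, ENNReal.ofReal ((3 / 2) ^ k) * (∫⁻ n, ∫⁻ x : Fin n → ℝ,
          ENNReal.ofReal ((levelSum meanKey k x Finset.univ - levelMean lam k) ^ 2)
            ∂(Measure.pi fun _ => unif) ∂(poissonMeasure lam)) := by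
        have inner (n : ℕ) := lintegral_add_left (μ := Measure.pi fun _ : Fin n => unif)
          (f := fun x => 225 * ∑' k, ENNReal.ofReal ((3 / 2) ^ k) *
            ENNReal.ofReal (levelSum orderedPairs k x Finset.univ))
          ((Measurable.tsum fun k => hm1 k n).const_mul _)
          fun x => 3 * ∑' k, ENNReal.ofReal ((3 / 2) ^ k) *
            ENNReal.ofReal ((levelSum meanKey k x Finset.univ - levelMean lam k) ^ 2)
        simp only [inner]
        rw [lintegral_add_left (measurable_of_countable _)]
        congr 1
        · simp only [lintegral_const_mul _ (Measurable.tsum fun k => hm1 k _)]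
          rw [lintegral_const_mul _ (measurable_of_countable _)]
          congr 1
          simp only [lintegral_tsum fun k => (hm1 k _).aemeasurable]
          rw [lintegral_tsum fun k => (measurable_of_countable _).aemeasurable]
          refine tsum_congr fun k => ?_
          simp only [lintegral_const_mul _
            (measurable_levelSum orderedPairs k _).ennreal_ofReal]
          rw [lintegral_const_mul _ (measurable_of_countable _)]
        · simp only [lintegral_const_mul _ (Measurable.tsum fun k => hm2 k _)]
          rw [lintegral_const_mul _ (measurable_of_countable _)]
          congr 1
          simp only [lintegral_tsum fun k => (hm2 k _).aemeasurable]
          rw [lintegral_tsum fun k => (measurable_of_countable _).aemeasurable]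
          refine tsum_congr fun k => ?_
          simp only [lintegral_const_mul _
            (((measurable_levelSum meanKey k _).sub_const _).pow_const 2).ennreal_ofReal]
          rw [lintegral_const_mul _ (measurable_of_countable _)]
    _ ≤ 225 * ∑' k : ℕ, ENNReal.ofReal ((3 / 2) ^ k) * ENNReal.ofReal ((lam : ℝ) ^ 2 / 2 ^ k) +
        3 * ∑' k : ℕ, ENNReal.ofReal ((3 / 2) ^ k) *
          ENNReal.ofReal ((40 * (lam : ℝ) ^ 2) / 2 ^ k) := by
        gcongr with k k
        · exact (lintegral_levelSum_orderedPairs lam k).le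
        · refine (lintegral_levelSum_meanKey_le lam k).trans (le_of_eq ?_)
          rw [mul_div_assoc]
    _ = _ := by
        rw [tsum_geometric_weight _ (by positivity), tsum_geometric_weight _ (by positivity),
          ← ENNReal.ofReal_ofNat 225, ← ENNReal.ofReal_ofNat 3, ← ENNReal.ofReal_mul (by norm_num),
          ← ENNReal.ofReal_mul (by norm_num), ← ENNReal.ofReal_add (by positivity) (by positivity)]
        congr 1
        ring

/-- Key comparisons are the case of the single level 0. The constant 225 + 40 would do; 1380 matches
the bit bound. -/
theorem lintegral_key_le (lam : ℝ≥0) :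
    ∫⁻ z, ENNReal.ofReal ((keyComparisons z - poissonMeanKey lam) ^ 2) ∂(poissonLaw lam) ≤
      ENNReal.ofReal (1380 * (lam : ℝ) ^ 2) := by
  have hlevel : levelMean lam 0 = poissonMeanKey lam := by simp [levelMean]
  have hcost (n : ℕ) (x : Fin n → ℝ) (hx : Function.Injective x)
      (hI : ∀ i, x i ∈ Set.Ico (0 : ℝ) 1) :
      ∫⁻ z, ENNReal.ofReal ((keyComparisons z - poissonMeanKey lam) ^ 2) ∂(costLaw n x) ≤
        225 * ENNReal.ofReal (levelSum orderedPairs 0 x Finset.univ) +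
          ENNReal.ofReal ((levelSum meanKey 0 x Finset.univ - levelMean lam 0) ^ 2) := by
    have h1 := tsum_quicksortCost_sq_le x (fun _ _ => 1) 1 Finset.univ hx.injOn (fun i _ => hI i)
      (fun i _ j _ hij => (commonLevels_one (hI i) (hI j)).symm) (poissonMeanKey lam)
    have h2 := lintegral_costLaw_comp x (AddMonoidHom.fst ℕ ℕ) fun m =>
      ENNReal.ofReal (((m : ℝ) - poissonMeanKey lam) ^ 2)
    refine (h2.trans_le h1).trans (le_of_eq ?_)
    have h3 := levelSum_nonneg orderedPairs_nonneg 0 x Finset.univ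
    rw [ENNReal.ofReal_add (by have := pairWeight_nonneg 1 x Finset.univ; positivity)
      (by positivity), ENNReal.ofReal_mul (by norm_num), hlevel]
    simp [pairWeight]
  rw [lintegral_poissonLaw]
  calc _ ≤ ∫⁻ n, ∫⁻ x : Fin n → ℝ,
        (225 * ENNReal.ofReal (levelSum orderedPairs 0 x Finset.univ) +
          ENNReal.ofReal ((levelSum meanKey 0 x Finset.univ - levelMean lam 0) ^ 2))
        ∂(Measure.pi fun _ => unif) ∂(poissonMeasure lam) := by
        refine lintegral_mono fun n => lintegral_mono_ae ?_
        filter_upwards [ae_injective n] with x hx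
        exact hcost n x hx.1 hx.2
    _ = 225 * (∫⁻ n, ∫⁻ x : Fin n → ℝ,
          ENNReal.ofReal (levelSum orderedPairs 0 x Finset.univ)
            ∂(Measure.pi fun _ => unif) ∂(poissonMeasure lam)) +
        ∫⁻ n, ∫⁻ x : Fin n → ℝ,
          ENNReal.ofReal ((levelSum meanKey 0 x Finset.univ - levelMean lam 0) ^ 2)
            ∂(Measure.pi fun _ => unif) ∂(poissonMeasure lam) := by
        simp only [lintegral_add_left
          ((measurable_levelSum orderedPairs 0 _).ennreal_ofReal.const_mul _),
          lintegral_const_mul _ (measurable_levelSum orderedPairs 0 _).ennreal_ofReal]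
        rw [lintegral_add_left (measurable_of_countable _),
          lintegral_const_mul _ (measurable_of_countable _)]
    _ ≤ 225 * ENNReal.ofReal ((lam : ℝ) ^ 2 / 2 ^ 0) +
          ENNReal.ofReal (40 * ((lam : ℝ) ^ 2 / 2 ^ 0)) := by
        gcongr
        · exact (lintegral_levelSum_orderedPairs lam 0).le
        · exact lintegral_levelSum_meanKey_le lam 0
    _ ≤ _ := by
        rw [← ENNReal.ofReal_ofNat 225, ← ENNReal.ofReal_mul (by norm_num),
          ← ENNReal.ofReal_add (by positivity) (by positivity)]
        refine ENNReal.ofReal_le_ofReal ?_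
        have : (0 : ℝ) ≤ (lam : ℝ) ^ 2 := by positivity
        simp only [pow_zero, div_one]
        linarith

theorem memLp_and_variance_bitComparisons_le (lam : ℝ≥0) :
    MemLp bitComparisons 2 (poissonLaw lam) ∧
      Var[bitComparisons; poissonLaw lam] ≤ 1380 * (lam : ℝ) ^ 2 := by
  have hm {f : ℕ × ℕ → ℝ} : AEStronglyMeasurable f (poissonLaw lam) :=
    (measurable_of_countable _).aestronglyMeasurable
  have hle := lintegral_bit_le lam
  have hint : Integrable (fun z => (bitComparisons z - poissonMeanBit lam) ^ 2)
      (poissonLaw lam) := by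
    refine ⟨hm, ?_⟩
    rw [hasFiniteIntegral_iff_ofReal (ae_of_all _ fun z => sq_nonneg _)]
    exact hle.trans_lt ENNReal.ofReal_lt_top
  have hL : MemLp (fun z => bitComparisons z - poissonMeanBit lam) 2 (poissonLaw lam) :=
    (memLp_two_iff_integrable_sq hm).2 hint
  constructor
  · have e : bitComparisons =
        (fun z => bitComparisons z - poissonMeanBit lam) + fun _ => poissonMeanBit lam := by
      funext z; simp
    rw [e]
    exact hL.add (memLp_const _)
  -- The second moment about any point bounds the variance, so the centre need not be identified as
  -- the mean.
  · rw [← variance_sub_const hm (poissonMeanBit lam)]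
    refine (variance_le_expectation_sq hm).trans ?_
    have h := integral_eq_lintegral_of_nonneg_ae
      (ae_of_all (poissonLaw lam) fun z => sq_nonneg (bitComparisons z - poissonMeanBit lam)) hm
    refine h.trans_le ?_
    exact ENNReal.toReal_le_of_le_ofReal (by positivity) hle

/-! ### Asymptotics of the centres and the ratio -/

theorem measure_le_abs_sub_le {Ω : Type*} [MeasurableSpace Ω] {μ : Measure Ω} {X : Ω → ℝ}
    (hX : Measurable X) {t v s : ℝ} (hs : 0 < s)
    (h : ∫⁻ z, ENNReal.ofReal ((X z - t) ^ 2) ∂μ ≤ ENNReal.ofReal v) :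
    μ {z | s ≤ |X z - t|} ≤ ENNReal.ofReal (v / s ^ 2) := by
  have h1 := mul_meas_ge_le_lintegral (μ := μ) (f := fun z => ENNReal.ofReal ((X z - t) ^ 2))
    (((hX.sub_const t).pow_const 2).ennreal_ofReal) (ENNReal.ofReal (s ^ 2))
  have hs2 : 0 < s ^ 2 := by positivity
  have e : {z | ENNReal.ofReal (s ^ 2) ≤ ENNReal.ofReal ((X z - t) ^ 2)} =
      {z | s ≤ |X z - t|} := by
    ext z
    simp only [Set.mem_ofPred_eq]
    rw [ENNReal.ofReal_le_ofReal_iff (sq_nonneg _), sq_le_sq, abs_of_pos hs]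
  rw [e] at h1
  rw [ENNReal.ofReal_div_of_pos hs2, ENNReal.le_div_iff_mul_le
    (Or.inl (by simpa using hs2.ne')) (Or.inl ENNReal.ofReal_ne_top), mul_comm]
  exact h1.trans h

theorem abs_poissonMeanKey_sub_log_le {mu : ℝ≥0} (h : 1 ≤ mu) :
    |poissonMeanKey mu - 2 * mu * Real.log mu| ≤ 13 * mu := by
  have hmu : (1 : ℝ) ≤ mu := by exact_mod_cast h
  have hfl : ⌊(mu : ℝ)⌋₊ = ⌊mu⌋₊ := by
    rw [Nat.floor_eq_iff (NNReal.coe_nonneg mu)]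
    exact ⟨by exact_mod_cast Nat.floor_le mu.2, by exact_mod_cast Nat.lt_floor_add_one mu⟩
  have h1 := Real.log_nonneg hmu
  have h2 := log_le_harmonic_floor (mu : ℝ) mu.2
  have h3 := harmonic_floor_le_one_add_log (mu : ℝ) hmu
  have h4 := Nat.floor_le (show (0 : ℝ) ≤ mu from mu.2)
  have h5 := Nat.lt_floor_add_one (mu : ℝ)
  have h6 := Real.log_le_sub_one_of_pos (show (0 : ℝ) < mu by linarith)
  rw [hfl] at h2 h3 h4 h5
  have h7 := abs_le.1 (abs_poissonMeanKey_sub_le mu)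
  rw [meanKey] at h7
  set m : ℝ := (⌊mu⌋₊ : ℝ)
  set H : ℝ := ((harmonic ⌊mu⌋₊ : ℚ) : ℝ)
  have h8 : (mu : ℝ) * Real.log mu ≤ (m + 1) * H :=
    mul_le_mul h5.le h2 h1 (by linarith)
  have h9 : (m + 1) * H ≤ ((mu : ℝ) + 1) * (1 + Real.log mu) :=
    mul_le_mul (by linarith) h3 (by linarith) (by linarith)
  rw [abs_le]
  constructor
  · linarith
  · nlinarith

theorem abs_levelMean_sub_le {lam : ℝ≥0} {k : ℕ} (h : 2 ^ k ≤ lam) :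
    |levelMean lam k - 2 * lam * (Real.log lam - k * Real.log 2)| ≤ 13 * lam := by
  have hk : (0 : ℝ) < 2 ^ k := by positivity
  have hl : (0 : ℝ) < lam := hk.trans_le (by exact_mod_cast h)
  have h1 : 1 ≤ lam / 2 ^ k := by rwa [one_le_div₀ (by positivity)]
  have h2 := abs_poissonMeanKey_sub_log_le h1
  push_cast at h2
  rw [Real.log_div hl.ne' hk.ne', Real.log_pow] at h2
  have e : levelMean lam k - 2 * lam * (Real.log lam - k * Real.log 2) =
      2 ^ k * (poissonMeanKey (lam / 2 ^ k) -
        2 * ((lam : ℝ) / 2 ^ k) * (Real.log lam - k * Real.log 2)) := by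
    rw [levelMean]; field_simp
  rw [e, abs_mul, abs_of_pos hk]
  refine (mul_le_mul_of_nonneg_left h2 hk.le).trans (le_of_eq ?_)
  field_simp

/-- Levels with 2^k ≤ lam contribute about 2 lam log 2 · (l - k), where l = lg lam, an arithmetic
sum near lam log 2 · l². Finer levels decay geometrically and total at most 2 lam. -/
theorem abs_poissonMeanBit_sub_le {lam : ℝ≥0} (h : 1 ≤ lam) :
    |poissonMeanBit lam - Real.log 2 * lam * Real.logb 2 lam ^ 2| ≤
      16 * lam * (Real.logb 2 lam + 1) := by
  have hlam : (1 : ℝ) ≤ lam := by exact_mod_cast h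
  have hlam0 : (0 : ℝ) < lam := by linarith
  have hlog2 : 0 < Real.log 2 := Real.log_pos (by norm_num)
  have hlog2' : Real.log 2 ≤ 1 := Real.log_two_lt_d9.le.trans (by norm_num)
  set l := Real.logb 2 lam with hl
  have hl0 : 0 ≤ l := Real.logb_nonneg (by norm_num) hlam
  have hlog : Real.log lam = l * Real.log 2 := by
    rw [hl, Real.logb, div_mul_cancel₀ _ hlog2.ne']
  set L := ⌊l⌋₊ with hL
  have hL1 : (L : ℝ) ≤ l := Nat.floor_le hl0
  have hL2 : l < L + 1 := Nat.lt_floor_add_one l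
  have hpow : ∀ k ∈ Finset.range (L + 1), 2 ^ k ≤ lam := fun k hk => by
    have hk' : (k : ℝ) ≤ l := le_trans (by exact_mod_cast Finset.mem_range_succ_iff.1 hk) hL1
    have h2 : (2 : ℝ) ^ (k : ℝ) ≤ lam := (Real.le_logb_iff_rpow_le (by norm_num) hlam0).1 hk'
    rw [Real.rpow_natCast] at h2
    exact_mod_cast h2
  have hpow' : (lam : ℝ) ≤ 2 ^ (L + 1) := by
    have h2 : (lam : ℝ) ≤ (2 : ℝ) ^ ((L + 1 : ℕ) : ℝ) :=
      (Real.logb_le_iff_le_rpow (by norm_num) hlam0).1 (by push_cast; exact hL2.le)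
    rwa [Real.rpow_natCast] at h2
  have hsplit := (summable_levelMean lam).sum_add_tsum_nat_add (L + 1)
  have htail0 : 0 ≤ ∑' k, levelMean lam (k + (L + 1)) :=
    tsum_nonneg fun k => levelMean_nonneg _ _
  have htail : ∑' k, levelMean lam (k + (L + 1)) ≤ 2 * lam := by
    have hg : Summable fun k : ℕ => (lam : ℝ) ^ 2 * (1 / 2) ^ (L + 1) * (1 / 2) ^ k :=
      (summable_geometric_of_lt_one (by norm_num) (by norm_num)).mul_left _
    calc _ ≤ ∑' k : ℕ, (lam : ℝ) ^ 2 * (1 / 2) ^ (L + 1) * (1 / 2) ^ k := by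
          refine Summable.tsum_le_tsum (fun k => ?_)
            ((summable_nat_add_iff (L + 1)).2 (summable_levelMean lam)) hg
          refine (levelMean_le _ _).trans (le_of_eq ?_)
          rw [pow_add]; ring
      _ = (lam : ℝ) ^ 2 * (1 / 2) ^ (L + 1) * 2 := by
          rw [tsum_mul_left, tsum_geometric_of_lt_one (by norm_num) (by norm_num)]
          norm_num
      _ ≤ _ := by
          have : (lam : ℝ) * (1 / 2) ^ (L + 1) ≤ 1 := by
            rw [one_div, inv_pow, ← div_eq_mul_inv, div_le_one (by positivity)]
            exact hpow'
          nlinarith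
  have hmain : |∑ k ∈ Finset.range (L + 1), levelMean lam k -
      Real.log 2 * lam * ((L + 1) * (2 * l - L))| ≤ 13 * lam * (L + 1) := by
    have e : Real.log 2 * lam * ((L + 1) * (2 * l - L)) =
        ∑ k ∈ Finset.range (L + 1), 2 * (lam : ℝ) * (Real.log lam - k * Real.log 2) := by
      have hg : (∑ k ∈ Finset.range (L + 1), (k : ℝ)) * 2 = (L + 1) * L := by
        have := Finset.sum_range_id_mul_two (L + 1)
        rw [Nat.add_sub_cancel] at this
        have h : ((∑ k ∈ Finset.range (L + 1), k : ℕ) : ℝ) * 2 = ((L + 1) * L : ℕ) := by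
          rw [← this]; push_cast; ring
        push_cast at h
        exact h
      rw [← Finset.mul_sum, Finset.sum_sub_distrib, ← Finset.sum_mul, hlog]
      simp only [Finset.sum_const, Finset.card_range, nsmul_eq_mul]
      push_cast
      linear_combination (Real.log 2 * lam) * hg
    rw [e, ← Finset.sum_sub_distrib]
    refine (Finset.abs_sum_le_sum_abs _ _).trans ?_
    refine (Finset.sum_le_sum fun k hk => abs_levelMean_sub_le (hpow k hk)).trans (le_of_eq ?_)
    simp only [Finset.sum_const, Finset.card_range, nsmul_eq_mul]
    push_cast
    ring
  -- With f = l - L in [0, 1), the difference equals l + f - f².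
  have hq0 : 0 ≤ ((L : ℝ) + 1) * (2 * l - L) - l ^ 2 := by nlinarith
  have hq1 : ((L : ℝ) + 1) * (2 * l - L) - l ^ 2 ≤ l + 1 := by nlinarith
  have hc : 0 < Real.log 2 * lam := by positivity
  have hc' : Real.log 2 * lam ≤ lam := by nlinarith
  have hq2 := mul_nonneg hc.le hq0
  have hq3 : Real.log 2 * lam * (((L : ℝ) + 1) * (2 * l - L) - l ^ 2) ≤ lam * (l + 1) :=
    mul_le_mul hc' hq1 hq0 hlam0.le
  have hm := abs_le.1 hmain
  have hL3 : (lam : ℝ) * (L + 1) ≤ lam * (l + 1) := by gcongr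
  have hl3 : 0 ≤ lam * l := by positivity
  rw [poissonMeanBit, ← hsplit, abs_le]
  constructor <;> nlinarith

/-- The hypotheses force k ≥ d/2, which excludes a zero denominator; the numerator of the error is
at most 2δad. -/
theorem abs_ratio_sub_one_le {a d b k δ : ℝ} (ha : 0 < a) (hd : 0 < d) (hδ : δ ≤ 1 / 2)
    (hb : |b - a| < δ * a) (hk : |k - d| < δ * d) : |d / a * (b / k) - 1| ≤ 4 * δ := by
  obtain ⟨b1, b2⟩ := abs_lt.1 hb
  obtain ⟨k1, k2⟩ := abs_lt.1 hk
  have hδ0 : 0 < δ := pos_of_mul_pos_left ((abs_nonneg _).trans_lt hb) ha.le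
  have hk0 : d / 2 ≤ k := by nlinarith
  have hk0' : 0 < k := by linarith
  have e : d / a * (b / k) - 1 = (d * (b - a) - a * (k - d)) / (a * k) := by
    field_simp; ring
  rw [e, abs_div, abs_of_pos (mul_pos ha hk0'), div_le_iff₀ (mul_pos ha hk0')]
  have h1 : |d * (b - a) - a * (k - d)| ≤ d * (δ * a) + a * (δ * d) := by
    refine (abs_sub _ _).trans ?_
    rw [abs_mul, abs_mul, abs_of_pos ha, abs_of_pos hd]
    gcongr
  refine h1.trans ?_
  have : δ * a * (d / 2) ≤ δ * a * k := mul_le_mul_of_nonneg_left hk0 (by positivity)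
  nlinarith

theorem poissonLaw_ratio_le {ε δ : ℝ} (hδ0 : 0 < δ) (hδ : δ ≤ 1 / 2) (hε : 4 * δ ≤ ε)
    {lam : ℝ≥0} (h1 : 1 ≤ lam) (hl : 128 / δ ≤ Real.logb 2 lam) :
    poissonLaw lam {z | ε < |2 / Real.logb 2 lam * (bitComparisons z / keyComparisons z) - 1|} ≤
      ENNReal.ofReal (30000 / δ ^ 2 * (Real.logb 2 lam ^ 2)⁻¹) := by
  have hlam : (1 : ℝ) ≤ lam := by exact_mod_cast h1
  have hlam0 : (0 : ℝ) < lam := by linarith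
  have hb := abs_poissonMeanBit_sub_le h1
  have hk := abs_poissonMeanKey_sub_log_le h1
  have hg0 : 1 / 2 ≤ Real.log 2 := le_trans (by norm_num) Real.log_two_gt_d9.le
  have hlog : Real.log lam = Real.logb 2 lam * Real.log 2 := by
    rw [Real.logb, div_mul_cancel₀ _ (by linarith)]
  rw [hlog] at hk
  set l := Real.logb 2 lam
  set g := Real.log 2
  rw [div_le_iff₀ hδ0] at hl
  have hl1 : 1 ≤ l := by nlinarith
  set a := g * lam * l ^ 2 with ha
  set d := 2 * lam * (l * g) with hd
  have ha1 : lam * l ^ 2 / 2 ≤ a := by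
    have := mul_le_mul_of_nonneg_right hg0 (show 0 ≤ lam * l ^ 2 by positivity)
    rw [ha]; nlinarith
  have hd1 : lam * l ≤ d := by
    have := mul_le_mul_of_nonneg_right hg0 (show 0 ≤ lam * l by positivity)
    rw [hd]; nlinarith
  have ha0 : 0 < a := lt_of_lt_of_le (by positivity) ha1
  have hd0 : 0 < d := lt_of_lt_of_le (by positivity) hd1
  have hda : d / a = 2 / l := by
    rw [ha, hd]; field_simp
  -- Half of the tolerance δ goes to the deterministic error and half to the fluctuation. The error
  -- 32 lam l fits into δ a / 2, given a ≥ lam l² / 2, once δ l ≥ 128.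
  have hB : |poissonMeanBit lam - a| ≤ δ * a / 2 := by
    refine hb.trans ?_
    have e1 : 16 * lam * (l + 1) ≤ lam * l * 32 := by nlinarith
    have e2 : lam * l * 128 ≤ lam * l * (l * δ) := mul_le_mul_of_nonneg_left hl (by positivity)
    have e3 := mul_le_mul_of_nonneg_left ha1 hδ0.le
    nlinarith
  have hK : |poissonMeanKey lam - d| ≤ δ * d / 2 := by
    refine hk.trans ?_
    have e2 : lam * 128 ≤ lam * (l * δ) := mul_le_mul_of_nonneg_left hl (by positivity)
    have e3 := mul_le_mul_of_nonneg_left hd1 hδ0.le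
    nlinarith
  have hsub : {z : ℕ × ℕ | ε < |2 / l * (bitComparisons z / keyComparisons z) - 1|} ⊆
      {z | δ * a / 2 ≤ |bitComparisons z - poissonMeanBit lam|} ∪
      {z | δ * d / 2 ≤ |keyComparisons z - poissonMeanKey lam|} := by
    intro z hz
    by_contra hcon
    simp only [Set.mem_union, Set.mem_ofPred_eq, not_or, not_le] at hcon hz
    have t1 := abs_sub_le (bitComparisons z) (poissonMeanBit lam) a
    have t2 := abs_sub_le (keyComparisons z) (poissonMeanKey lam) d
    have := abs_ratio_sub_one_le ha0 hd0 hδ (b := bitComparisons z) (k := keyComparisons z)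
      (by linarith [hcon.1]) (by linarith [hcon.2])
    rw [hda] at this
    linarith
  refine (measure_mono hsub).trans ((measure_union_le _ _).trans ?_)
  have m1 := measure_le_abs_sub_le (measurable_of_countable bitComparisons)
    (show 0 < δ * a / 2 by positivity) (lintegral_bit_le lam)
  have m2 := measure_le_abs_sub_le (measurable_of_countable keyComparisons)
    (show 0 < δ * d / 2 by positivity) (lintegral_key_le lam)
  refine (add_le_add m1 m2).trans ?_
  rw [← ENNReal.ofReal_add (by positivity) (by positivity)]
  refine ENNReal.ofReal_le_ofReal ?_
  have bound (s : ℝ) (hs : lam * l / 2 ≤ s) :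
      1380 * (lam : ℝ) ^ 2 / (δ * s / 2) ^ 2 ≤ 22080 / δ ^ 2 * (l ^ 2)⁻¹ := by
    have : 0 < lam * l / 2 := by positivity
    calc _ ≤ 1380 * (lam : ℝ) ^ 2 / (δ * (lam * l / 2) / 2) ^ 2 := by gcongr
      _ = _ := by field_simp; norm_num
  have b1 := bound a (le_trans (by nlinarith [mul_nonneg hlam0.le (sub_nonneg.2 hl1)]) ha1)
  have b2 : 1380 * (lam : ℝ) ^ 2 / (δ * d / 2) ^ 2 ≤ 5520 / δ ^ 2 * (l ^ 2)⁻¹ := by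
    calc _ ≤ 1380 * (lam : ℝ) ^ 2 / (δ * (lam * l) / 2) ^ 2 := by gcongr
      _ = _ := by field_simp; norm_num
  have : 0 ≤ 1 / δ ^ 2 * (l ^ 2)⁻¹ := by positivity
  calc _ ≤ _ := add_le_add b1 b2
    _ = 27600 * (1 / δ ^ 2 * (l ^ 2)⁻¹) := by ring
    _ ≤ 30000 * (1 / δ ^ 2 * (l ^ 2)⁻¹) := by linarith
    _ = _ := by ring

end BitQuicksort

theorem proposition5p5 :
    (∃ c : ℝ, ∀ lam : ℝ≥0, 0 < lam →
      MemLp BitQuicksort.bitComparisons 2 (BitQuicksort.poissonLaw lam) ∧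
      Var[BitQuicksort.bitComparisons; BitQuicksort.poissonLaw lam] ≤ c ^ 2 * (lam : ℝ) ^ 2) ∧
    (∀ ε : ℝ, 0 < ε →
      Tendsto (fun lam : ℝ≥0 => BitQuicksort.poissonLaw lam
        {z | ε < |2 / Real.logb 2 lam *
          (BitQuicksort.bitComparisons z / BitQuicksort.keyComparisons z) - 1|})
        atTop (𝓝 0)) := by
  constructor
  -- 38² = 1444 exceeds 1380.
  · refine ⟨38, fun lam _ => ?_⟩
    obtain ⟨h1, h2⟩ := BitQuicksort.memLp_and_variance_bitComparisons_le lam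
    refine ⟨h1, h2.trans ?_⟩
    nlinarith [sq_nonneg (lam : ℝ)]
  · intro ε hε
    set δ : ℝ := min (1 / 2) (ε / 4) with hδ
    have hδ0 : 0 < δ := by positivity
    have hlog : Tendsto (fun lam : ℝ≥0 => Real.logb 2 lam) atTop atTop :=
      (Real.tendsto_logb_atTop (by norm_num)).comp (NNReal.tendsto_coe_atTop.2 tendsto_id)
    have hlim : Tendsto (fun lam : ℝ≥0 =>
        ENNReal.ofReal (30000 / δ ^ 2 * (Real.logb 2 lam ^ 2)⁻¹)) atTop (𝓝 0) := by
      have h1 : Tendsto (fun lam : ℝ≥0 => (Real.logb 2 lam ^ 2)⁻¹) atTop (𝓝 0) :=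
        tendsto_inv_atTop_zero.comp ((tendsto_pow_atTop (by norm_num)).comp hlog)
      simpa using ENNReal.tendsto_ofReal (h1.const_mul (30000 / δ ^ 2))
    refine tendsto_of_tendsto_of_tendsto_of_le_of_le' tendsto_const_nhds hlim
      (Eventually.of_forall fun _ => zero_le) ?_
    filter_upwards [eventually_ge_atTop 1, hlog.eventually_ge_atTop (128 / δ)] with lam h1 h2
    exact BitQuicksort.poissonLaw_ratio_le hδ0 (min_le_left _ _)
      (by have := min_le_right (1 / 2) (ε / 4); rw [← hδ] at this; linarith) h1 h2
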